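/- Let $\sigma_d$ be the uniform probability distribution on the unit sphere $S^{d-1}\subset\mathbb R^d$. For $c>0$, a distribution $D$ on $S^{d-1}$ is called $c$-non-concentrated if it has a density with respect to $\sigma_d$ that is at most $c$ everywhere. There are $k\ge 1$ players; player $i$ can sample from an unknown distribution $D_i$ on $S^{d-1}$, and examples $x$ are labeled by an unknown homogeneous linear separator, $\ell(x)=\operatorname{sign}(w^*\cdot x)$ with $w^*\ne 0$ (and $\operatorname{sign}(0)=1$). The error of a hypothesis vector $w$ is $\Pr_{x\sim D}[\ell(x)(w\cdot x)\le 0]$, where $D=\frac1k\sum_i D_i$. In the round-robin margin Perceptron with parameters $m\in\mathbb N$ and $\beta\in[0,1]$, the players take turns in the cyclic order $1,\dots,k,1,\dots$. Each turn is one round of communication, in which the player receives the current hypothesis vector $w$ (initially $0$) with a counter, draws $m$ fresh examples from $D_i$, and sends a single hypothesis vector with a counter to the next player. Passes through all $k$ players alternate between test passes (the first pass is one) and update passes. In a test pass $w$ is passed along unchanged and the counter adds up the number of drawn examples with $\ell(x)(w\cdot x)\le 0$. In an update pass each player selects each of its drawn examples independently with probability $\beta$ and runs through the selected ones, replacing $w$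 by $w+\ell(x)x$ whenever $\ell(x)(w\cdot x)<1$. The process stops with output $w$ at the end of the first test pass in which at most an $\varepsilon/2$ fraction of the $km$ examples was counted. Theorem. There is an absolute constant $p$, and for every $c>0$ and $\delta>0$ there is a constant $C$ depending only on $c$ and $\delta$, such that for all $d,k\ge1$ and all $0<\varepsilon\le\frac12$ there are parameters $R,m\in\mathbb N$ and $\beta\in[0,1]$ with $$R\le C\,\frac{k^2\sqrt{d\log(dk/\varepsilon)}}{\varepsilon^2},\qquad R\,m\le C\Big(\frac{dk}{\varepsilon}\Big)^p,$$ and such that for all $D_1,\dots,D_k$ whose mixture $D$ is $c$-non-concentrated and every target $w^*\neq0$, with probability at least $1-\delta$ the round-robin margin Perceptron stops after at most $R$ rounds, each communicating a single hypothesis vector, and outputs a hypothesis of error at most $\varepsilon$ under $D$. -/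

import Mathlib

open MeasureTheory

noncomputable section

/-- Points of the unit sphere of `ℝ^d`. -/
abbrev SpherePt (d : ℕ) : Type := Metric.sphere (0 : EuclideanSpace ℝ (Fin d)) 1

/-- The uniform probability distribution on the unit sphere of `ℝ^d`: normalized surface measure. -/
def sphereUniform (d : ℕ) : Measure (SpherePt d) :=
  ((volume : Measure (EuclideanSpace ℝ (Fin d))).toSphere Set.univ)⁻¹ •
    (volume : Measure (EuclideanSpace ℝ (Fin d))).toSphere

/-- `D` is non-concentrated with constant `c`: it has a density with respect to the uniform
distribution on the sphere, and this density is at most `c` everywhere. -/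
def NonConcentrated {d : ℕ} (c : ℝ) (D : Measure (SpherePt d)) : Prop :=
  ∃ p : SpherePt d → ENNReal, Measurable p ∧ (∀ x, p x ≤ ENNReal.ofReal c) ∧
    D = (sphereUniform d).withDensity p

/-- The overall distribution: the mixture `(1/k) ∑ i, D i` of the players' distributions. -/
def mixture {d k : ℕ} (D : Fin k → Measure (SpherePt d)) : Measure (SpherePt d) :=
  (k : ENNReal)⁻¹ • ∑ i, D i

/-- The `±1` label that the homogeneous linear separator with normal vector `w` gives to `x`. -/
def sepLabel {d : ℕ} (w : EuclideanSpace ℝ (Fin d)) (x : SpherePt d) : ℝ :=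
  if 0 ≤ inner ℝ w (x : EuclideanSpace ℝ (Fin d)) then 1 else -1

/-- A labeled example, together with a private random coin (uniform on `[0, 1]`) of the player
who draws it. -/
structure Draw (d : ℕ) where
  point : SpherePt d
  label : ℝ
  coin : unitInterval

/-- `ℓ(x) (w · x)`: the signed (unnormalized) margin of a labeled example under `w`. -/
def Draw.margin {d : ℕ} (w : EuclideanSpace ℝ (Fin d)) (e : Draw d) : ℝ :=
  e.label * inner ℝ w (e.point : EuclideanSpace ℝ (Fin d))

/-- The content of one round of communication: a single hypothesis vector, along with a counter. -/
structure Message (d : ℕ) where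
  hyp : EuclideanSpace ℝ (Fin d)
  count : ℕ

open Classical in
/-- A player's turn in a test pass: the hypothesis is passed along unchanged, and the number of
the player's own fresh examples that it misclassifies is added to the counter. -/
def testTurn {d m : ℕ} (S : Fin m → Draw d) (M : Message d) : Message d where
  hyp := M.hyp
  count := M.count + (Finset.univ.filter fun j => (S j).margin M.hyp ≤ 0).card

open Classical in
/-- One margin-Perceptron step: if the example was selected by its coin (which happens with
probability `β`) and satisfies `ℓ(x) (w · x) < 1`, replace `w` by `w + ℓ(x) x`. -/
def marginStep {d : ℕ} (β : unitInterval) (w : EuclideanSpace ℝ (Fin d)) (e : Draw d) :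
    EuclideanSpace ℝ (Fin d) :=
  if e.coin < β ∧ e.margin w < 1 then
    w + e.label • (e.point : EuclideanSpace ℝ (Fin d))
  else w

/-- A player's turn in an update pass: starting from the hypothesis received, the player runs the
margin Perceptron through its own fresh examples and sends on the resulting hypothesis. The
counter is reset. -/
def updateTurn {d m : ℕ} (β : unitInterval) (S : Fin m → Draw d) (M : Message d) :
    Message d where
  hyp := (List.ofFn S).foldl (marginStep β) M.hyp
  count := 0

/-- The round-robin margin Perceptron with `k` players. In round `t` (counted from `0`) player
`t mod k` receives the message of the previous round, draws the `m` fresh examples `S t`, and sends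
one message. Rounds are grouped into passes of `k` consecutive rounds, so that each player has one
turn in each pass; test passes and update passes alternate, beginning with a test pass.
`transcript k m β S t` is the message sent after `t` rounds; the initial hypothesis is `0`. -/
def transcript {d : ℕ} (k m : ℕ) (β : unitInterval) (S : ℕ → Fin m → Draw d) : ℕ → Message d
  | 0 => ⟨0, 0⟩
  | t + 1 =>
    if t / k % 2 = 0 then testTurn (S t) (transcript k m β S t)
    else updateTurn β (S t) (transcript k m β S t)

/-- The stopping rule: `t` rounds complete a test pass, and in this pass at most an `ε/2` fraction
of the `k * m` examples tested was misclassified. -/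
def StopsAt {d : ℕ} (k m : ℕ) (β : unitInterval) (ε : ℝ) (S : ℕ → Fin m → Draw d) (t : ℕ) : Prop :=
  t % (2 * k) = k ∧ ((transcript k m β S t).count : ℝ) ≤ ε / 2 * (k * m)

/-- The examples drawn, labeled by the target separator `wstar`. -/
def labelDraws {d m : ℕ} (wstar : EuclideanSpace ℝ (Fin d))
    (ω : ℕ → Fin m → SpherePt d × unitInterval) : ℕ → Fin m → Draw d :=
  fun t j => ⟨(ω t j).1, sepLabel wstar (ω t j).1, (ω t j).2⟩

/-- The law of the players' data: all draws and coins are independent, and the points drawn in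
round `t` have the distribution of the player `t mod k` who draws them. -/
def drawLaw {d k : ℕ} [NeZero k] (m : ℕ) (D : Fin k → Measure (SpherePt d))
    [∀ i, IsProbabilityMeasure (D i)] :
    Measure (ℕ → Fin m → SpherePt d × unitInterval) :=
  Measure.infinitePi fun t =>
    Measure.pi fun _ : Fin m => (D (Fin.ofNat k t)).prod (volume : Measure unitInterval)

/-- The error under `D` of the hypothesis `w` for the target `wstar`: the probability of
`ℓ(x) (w · x) ≤ 0`. Points on the boundary of `w` count as errors. -/
def sepError {d : ℕ} (D : Measure (SpherePt d)) (wstar w : EuclideanSpace ℝ (Fin d)) : ENNReal :=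
  D {x | sepLabel wstar x * inner ℝ w (x : EuclideanSpace ℝ (Fin d)) ≤ 0}

/-- The run stops after at most `R` rounds, and the hypothesis it holds when it (first) stops has
error at most `ε` under `D`. -/
def LearnsWithin {d : ℕ} (k m : ℕ) (β : unitInterval) (ε : ℝ) (R : ℕ) (D : Measure (SpherePt d))
    (wstar : EuclideanSpace ℝ (Fin d)) (S : ℕ → Fin m → Draw d) : Prop :=
  ∃ t ≤ R, StopsAt k m β ε S t ∧ (∀ s < t, ¬ StopsAt k m β ε S s) ∧
    sepError D wstar (transcript k m β S t).hyp ≤ ENNReal.ofReal ε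

end

/-! The proof plays the Perceptron potential argument against the number of updates that one pass
achieves in parallel.

Normalize the target `ws` to length one. Every update has margin below 1, so it raises the squared
norm of the hypothesis `w` by at most 3. An update on an example with `|ws · x| > γ` raises `ws · w`
by more than `γ`, and no update lowers it. If `M` updates occur and at most `M / 2` selected
examples lie within `γ` of the target's boundary, Cauchy-Schwarz gives `γ² M ≤ 12`. A slab of
half-width `γ` has uniform measure at most `12 γ √d`, so with `γ` of order `ε / √d` near-boundary
examples are rare enough, and the total number of updates is of order `d / ε²`.

The update threshold 1, instead of 0, makes a single pass productive. If the hypothesis at the start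
of a pass has error at least `ε / 4`, about `s` selected examples or more are misclassified by it.
Such an example still triggers an update when its turn comes, unless the displacement `v`
accumulated so far in the pass satisfies `|v · x| ≥ 1`. While there are fewer than `s` updates, `‖v‖
≤ s - 1`; as `x` is independent of `v`, the cap estimate bounds the uniform probability of this
event by `2 exp(-d / (2 s²))`. Hence `s` of order `√(d / log (dk/ε))` updates per pass can be
expected, and of order `√(d log (dk/ε)) / ε²` passes suffice.

Heterogeneity of the players costs little. Expected counts over a full pass see only the mixture.
Only the displacement estimate looks at a single player, whose density can be `k` times larger, and
this factor ends up inside the logarithm.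

The run fails only if a test misjudges its hypothesis (Chernoff and a union bound), near-boundary
examples are too many (Markov), or half of the passes are slow (Markov). These counts are combined
in `learnsWithin_of_counts`; the decisive estimates are `updates_bound` and
`measure_few_updates_le`. -/

noncomputable section

/-! ### Independent coordinates, adapted states and a Chernoff bound -/

/-- Resampling one coordinate of a sequence of independent variables preserves its law. -/
theorem map_update_infinitePi {ι X : Type*} [DecidableEq ι] [MeasurableSpace X]
    (μ : ι → Measure X) [∀ i, IsProbabilityMeasure (μ i)] (n : ι) :
    ((Measure.infinitePi μ).prod (μ n)).map (fun p => Function.update p.1 n p.2) =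
      Measure.infinitePi μ := by
  have hmeas : Measurable fun p : (ι → X) × X => Function.update p.1 n p.2 := by
    refine measurable_pi_lambda _ fun i => ?_
    by_cases h : i = n
    · subst h; simpa using measurable_snd
    · simp only [Function.update_of_ne h]
      exact (measurable_pi_apply i).comp measurable_fst
  refine Measure.eq_infinitePi μ fun s t ht => ?_
  rw [Measure.map_apply hmeas (.pi s.countable_toSet fun i _ => ht i)]
  have hset : (fun p : (ι → X) × X => Function.update p.1 n p.2) ⁻¹' (Set.pi s t) =
      (Set.pi (s.erase n) t) ×ˢ (if n ∈ s then t n else Set.univ) := by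
    ext p
    simp only [Set.mem_preimage, Set.mem_pi, Set.mem_prod, Finset.mem_coe, Finset.mem_erase]
    constructor
    · intro h
      refine ⟨fun i hi => by simpa [hi.1] using h i hi.2, ?_⟩
      split_ifs with hn
      · simpa using h n hn
      · trivial
    · rintro ⟨h1, h2⟩ i hi
      by_cases hin : i = n
      · subst hin; simpa [hi] using h2
      · simpa [hin] using h1 i ⟨hin, hi⟩
  rw [hset, Measure.prod_prod, Measure.infinitePi_pi _ fun i _ => ht i]
  split_ifs with hn
  · exact Finset.prod_erase_mul _ _ hn
  · simp [Finset.erase_eq_of_notMem hn]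

/-- Given the coordinates other than `n`, the coordinate `n` has law `μ n`. -/
theorem lintegral_infinitePi_resample {ι X α : Type*} [DecidableEq ι] [MeasurableSpace X]
    [MeasurableSpace α] (μ : ι → Measure X) [∀ i, IsProbabilityMeasure (μ i)] (n : ι)
    {f : (ι → X) → α} (hf : Measurable f) (hfn : ∀ y z, f (Function.update y n z) = f y)
    {F : α × X → ENNReal} (hF : Measurable F) :
    ∫⁻ y, F (f y, y n) ∂(Measure.infinitePi μ) =
      ∫⁻ y, ∫⁻ z, F (f y, z) ∂(μ n) ∂(Measure.infinitePi μ) := by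
  have hmeas : Measurable fun p : (ι → X) × X => Function.update p.1 n p.2 := by
    refine measurable_pi_lambda _ fun i => ?_
    by_cases h : i = n
    · subst h; simpa using measurable_snd
    · simp only [Function.update_of_ne h]
      exact (measurable_pi_apply i).comp measurable_fst
  have hG : Measurable fun y : ι → X => F (f y, y n) :=
    hF.comp (hf.prodMk (measurable_pi_apply n))
  conv_lhs => rw [← map_update_infinitePi μ n]
  rw [lintegral_map hG hmeas, lintegral_prod (fun p : (ι → X) × X =>
    F (f (Function.update p.1 n p.2), Function.update p.1 n p.2 n)) (hG.comp hmeas).aemeasurable]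
  simp [hfn]

/-- The measure of an event on the state `f` and the coordinate `n` is bounded by a uniform bound
for its sections. -/
theorem measure_infinitePi_resample_le {ι X α : Type*} [DecidableEq ι] [MeasurableSpace X]
    [MeasurableSpace α] (μ : ι → Measure X) [∀ i, IsProbabilityMeasure (μ i)] (n : ι)
    {f : (ι → X) → α} (hf : Measurable f) (hfn : ∀ y z, f (Function.update y n z) = f y)
    {S : Set (α × X)} (hS : MeasurableSet S) {b : ENNReal}
    (hb : ∀ a, μ n {z | (a, z) ∈ S} ≤ b) :
    Measure.infinitePi μ {y | (f y, y n) ∈ S} ≤ b := by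
  have hm : MeasurableSet {y : ι → X | (f y, y n) ∈ S} :=
    (hf.prodMk (measurable_pi_apply n)) hS
  have := lintegral_infinitePi_resample μ n hf hfn (F := S.indicator 1)
    (measurable_one.indicator hS)
  have h1 : ∫⁻ y, S.indicator 1 (f y, y n) ∂(Measure.infinitePi μ) =
      Measure.infinitePi μ {y | (f y, y n) ∈ S} := by
    rw [← lintegral_indicator_one hm]; rfl
  rw [← h1, this]
  calc _ ≤ ∫⁻ _, b ∂(Measure.infinitePi μ) := by
        refine lintegral_mono fun y => ?_
        have h2 : MeasurableSet {z | (f y, z) ∈ S} := measurable_prodMk_left hS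
        have h3 : ∫⁻ z, S.indicator 1 (f y, z) ∂(μ n) = μ n {z | (f y, z) ∈ S} := by
          rw [← lintegral_indicator_one h2]; rfl
        exact h3.trans_le (hb _)
    _ = b := by simp

/-- Conditionally on a state `f` that depends only on coordinates before `n₀`, the coordinates
from `n₀` on are independent. -/
theorem lintegral_infinitePi_block {X α : Type*} [MeasurableSpace X]
    [MeasurableSpace α] (μ : ℕ → Measure X) [∀ i, IsProbabilityMeasure (μ i)] (n₀ : ℕ)
    {f : (ℕ → X) → α} (hf : Measurable f)
    (hfn : ∀ n y z, n₀ ≤ n → f (Function.update y n z) = f y)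
    {g : α × X → ENNReal} (hg : Measurable g) (l : ℕ) {H : α → ENNReal} (hH : Measurable H) :
    ∫⁻ y, H (f y) * ∏ j ∈ Finset.range l, g (f y, y (n₀ + j)) ∂(Measure.infinitePi μ) =
      ∫⁻ y, H (f y) * ∏ j ∈ Finset.range l, ∫⁻ z, g (f y, z) ∂(μ (n₀ + j))
        ∂(Measure.infinitePi μ) := by
  induction l generalizing H with
  | zero => simp
  | succ l ih =>
    have hprod : Measurable fun y : ℕ → X => ∏ j ∈ Finset.range l, g (f y, y (n₀ + j)) :=
      Finset.measurable_prod _ fun j _ => hg.comp (hf.prodMk (measurable_pi_apply _))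
    have hst : Measurable fun y : ℕ → X =>
        (H (f y) * ∏ j ∈ Finset.range l, g (f y, y (n₀ + j)), f y) :=
      ((hH.comp hf).mul hprod).prodMk hf
    have hr := lintegral_infinitePi_resample μ (n₀ + l) hst (fun y z => by
      have : ∀ j ∈ Finset.range l, g (f y, Function.update y (n₀ + l) z (n₀ + j)) =
          g (f y, y (n₀ + j)) := fun j hj => by
        rw [Function.update_of_ne]; have := Finset.mem_range.1 hj; omega
      simp only [hfn _ _ _ (Nat.le_add_right n₀ l), Finset.prod_congr rfl this])
      (F := fun p : (ENNReal × α) × X => p.1.1 * g (p.1.2, p.2)) (by fun_prop)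
    have hint : Measurable fun a : α => ∫⁻ z, g (a, z) ∂(μ (n₀ + l)) :=
      hg.lintegral_prod_right'
    -- The last factor, once integrated, depends on the state alone and is absorbed into `H`; this
    -- is why the induction generalizes `H`.
    have hi := ih (H := fun a => H a * ∫⁻ z, g (a, z) ∂(μ (n₀ + l))) (hH.mul hint)
    simp only [Finset.prod_range_succ]
    simp only at hr
    calc _ = ∫⁻ y, H (f y) * (∏ j ∈ Finset.range l, g (f y, y (n₀ + j))) *
          g (f y, y (n₀ + l)) ∂(Measure.infinitePi μ) := by simp only [mul_assoc]
      _ = _ := hr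
      _ = ∫⁻ y, (H (f y) * ∫⁻ z, g (f y, z) ∂(μ (n₀ + l))) *
          ∏ j ∈ Finset.range l, g (f y, y (n₀ + j)) ∂(Measure.infinitePi μ) := by
        refine lintegral_congr fun y => ?_
        rw [lintegral_const_mul (f := fun z => g (f y, z)) _ (hg.comp measurable_prodMk_left)]
        ring
      _ = _ := hi
      _ = _ := by
        refine lintegral_congr fun y => ?_
        ring

open Classical in
/-- A Chernoff bound: the number of coordinates in a block whose value is in `S`, when the state
`f` at the beginning of the block is in `G`. -/
theorem measure_block_count_le {X α : Type*} [MeasurableSpace X]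
    [MeasurableSpace α] (μ : ℕ → Measure X) [∀ i, IsProbabilityMeasure (μ i)] (n₀ : ℕ)
    {f : (ℕ → X) → α} (hf : Measurable f)
    (hfn : ∀ n y z, n₀ ≤ n → f (Function.update y n z) = f y)
    {S : Set (α × X)} (hS : MeasurableSet S) {G : Set α} (hG : MeasurableSet G) (l : ℕ)
    {lam b θ : ℝ} (hlam : 0 < lam)
    (hb : ∀ a ∈ G, (lam - 1) *
      ∑ j ∈ Finset.range l, (μ (n₀ + j)).real {z | (a, z) ∈ S} ≤ b) (hθ : 0 < θ) :
    Measure.infinitePi μ {y | f y ∈ G ∧ θ ≤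
        lam ^ (∑ j ∈ Finset.range l, if (f y, y (n₀ + j)) ∈ S then 1 else 0)} ≤
      ENNReal.ofReal (Real.exp b / θ) := by
  -- The product of `g` over the block is `lam ^ count`. Its conditional expectation is at most `exp
  -- ((lam - 1) ∑ p_j)` by `1 + x ≤ exp x`, and Markov finishes. Both `lam < 1` and `lam > 1` are
  -- allowed, giving the lower and the upper tail.
  set g : α × X → ENNReal := fun p => if p ∈ S then ENNReal.ofReal lam else 1 with hgdef
  have hg : Measurable g := Measurable.ite hS measurable_const measurable_const
  set H : α → ENNReal := G.indicator 1 with hHdef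
  have hH : Measurable H := measurable_one.indicator hG
  have hblock := lintegral_infinitePi_block μ n₀ hf hfn hg l hH
  have hpow : ∀ y : ℕ → X, ∏ j ∈ Finset.range l, g (f y, y (n₀ + j)) = ENNReal.ofReal
      (lam ^ (∑ j ∈ Finset.range l, if (f y, y (n₀ + j)) ∈ S then 1 else 0)) := by
    intro y
    rw [← Finset.prod_pow_eq_pow_sum, ENNReal.ofReal_prod_of_nonneg fun _ _ => by positivity]
    refine Finset.prod_congr rfl fun j _ => ?_
    simp only [hgdef]
    split_ifs <;> simp
  have hup : ∫⁻ y, H (f y) * ∏ j ∈ Finset.range l, ∫⁻ z, g (f y, z) ∂(μ (n₀ + j))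
        ∂(Measure.infinitePi μ) ≤ ENNReal.ofReal (Real.exp b) := by
    calc _ ≤ ∫⁻ _, ENNReal.ofReal (Real.exp b) ∂(Measure.infinitePi μ) := by
          refine lintegral_mono fun y => ?_
          by_cases hy : f y ∈ G
          · have hone : ∀ j, ∫⁻ z, g (f y, z) ∂(μ (n₀ + j)) ≤ ENNReal.ofReal
                (Real.exp ((lam - 1) * (μ (n₀ + j)).real {z | (f y, z) ∈ S})) := by
              intro j
              have hsl : MeasurableSet {z | (f y, z) ∈ S} := measurable_prodMk_left hS
              have h1 : ∫⁻ z, g (f y, z) ∂(μ (n₀ + j)) =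
                  ENNReal.ofReal lam * μ (n₀ + j) {z | (f y, z) ∈ S} +
                  μ (n₀ + j) {z | (f y, z) ∈ S}ᶜ := by
                rw [← lintegral_add_compl _ hsl]
                congr 1
                · rw [setLIntegral_congr_fun hsl (g := fun _ => ENNReal.ofReal lam)]
                  · simp
                  · intro z hz
                    have hz' : (f y, z) ∈ S := hz
                    simp [hgdef, hz']
                · rw [setLIntegral_congr_fun hsl.compl (g := fun _ => 1)]
                  · simp
                  · intro z hz
                    have hz' : (f y, z) ∉ S := hz
                    simp [hgdef, hz']
              have h2 : μ (n₀ + j) {z | (f y, z) ∈ S} =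
                  ENNReal.ofReal ((μ (n₀ + j)).real {z | (f y, z) ∈ S}) := by
                simp [Measure.real]
              have h3 : μ (n₀ + j) {z | (f y, z) ∈ S}ᶜ =
                  ENNReal.ofReal (1 - (μ (n₀ + j)).real {z | (f y, z) ∈ S}) := by
                rw [← probReal_compl_eq_one_sub hsl]; simp [Measure.real]
              have hle : (μ (n₀ + j)).real {z | (f y, z) ∈ S} ≤ 1 := measureReal_le_one
              rw [h1, h2, h3, ← ENNReal.ofReal_mul hlam.le,
                ← ENNReal.ofReal_add (by positivity) (by linarith)]
              refine ENNReal.ofReal_le_ofReal ?_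
              have := Real.add_one_le_exp ((lam - 1) * (μ (n₀ + j)).real {z | (f y, z) ∈ S})
              linarith
            calc _ ≤ 1 * ∏ j ∈ Finset.range l, ENNReal.ofReal
                    (Real.exp ((lam - 1) * (μ (n₀ + j)).real {z | (f y, z) ∈ S})) := by
                  refine mul_le_mul' ?_ (Finset.prod_le_prod' fun j _ => hone j)
                  simp [hHdef, hy]
              _ = ENNReal.ofReal (Real.exp ((lam - 1) *
                    ∑ j ∈ Finset.range l, (μ (n₀ + j)).real {z | (f y, z) ∈ S})) := by
                  rw [one_mul, ← ENNReal.ofReal_prod_of_nonneg fun _ _ => by positivity,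
                    ← Real.exp_sum, Finset.mul_sum]
              _ ≤ _ := ENNReal.ofReal_le_ofReal (Real.exp_le_exp.2 (hb _ hy))
          · simp [hHdef, hy]
      _ = _ := by simp
  have hlow : ENNReal.ofReal θ * Measure.infinitePi μ {y | f y ∈ G ∧ θ ≤
        lam ^ (∑ j ∈ Finset.range l, if (f y, y (n₀ + j)) ∈ S then 1 else 0)} ≤
      ∫⁻ y, H (f y) * ∏ j ∈ Finset.range l, g (f y, y (n₀ + j)) ∂(Measure.infinitePi μ) := by
    have hmeas : Measurable fun y : ℕ → X =>
        H (f y) * ∏ j ∈ Finset.range l, g (f y, y (n₀ + j)) :=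
      (hH.comp hf).mul
        (Finset.measurable_prod _ fun j _ => hg.comp (hf.prodMk (measurable_pi_apply _)))
    refine le_trans ?_ (mul_meas_ge_le_lintegral hmeas (ENNReal.ofReal θ))
    gcongr
    rintro ⟨h1, h2⟩
    simp only [hHdef, h1, Set.indicator_of_mem, Pi.one_apply, one_mul, hpow]
    exact ENNReal.ofReal_le_ofReal h2
  rw [ENNReal.ofReal_div_of_pos hθ, ENNReal.le_div_iff_mul_le (by simp [hθ]) (by simp), mul_comm]
  exact hlow.trans (hblock.le.trans hup)

/-! ### From rounds of samples to one sequence of draws -/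

/-- Reading the samples of all rounds, of `m` draws each, one after the other. -/
def flatten {X : Type*} (m : ℕ) [NeZero m] (ω : ℕ → Fin m → X) : ℕ → X :=
  fun n => ω (n / m) (Fin.ofNat m n)

theorem measurable_flatten {X : Type*} [MeasurableSpace X] (m : ℕ) [NeZero m] :
    Measurable (flatten m : (ℕ → Fin m → X) → ℕ → X) := by
  unfold flatten; fun_prop

/-- Currying and reindexing along `Nat.divModEquiv` both carry product measures to product measures,
and `flatten` inverts their composite. -/
theorem map_flatten {X : Type*} [MeasurableSpace X] (m : ℕ) [NeZero m] (ν : ℕ → Measure X)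
    [∀ i, IsProbabilityMeasure (ν i)] :
    (Measure.infinitePi fun t => Measure.pi fun _ : Fin m => ν t).map (flatten m) =
      Measure.infinitePi fun n => ν (n / m) := by
  have h1 := Measure.infinitePi_map_curry (fun (t : ℕ) (_ : Fin m) => ν t)
  have h2 := Measure.infinitePi_map_piCongrLeft (X := fun _ : ℕ × Fin m => X)
    (fun p : ℕ × Fin m => ν p.1) (Nat.divModEquiv m)
  simp only [Measure.infinitePi_eq_pi] at h1
  rw [← h1, ← h2, Measure.map_map (measurable_flatten m) (by fun_prop),
    Measure.map_map ((measurable_flatten m).comp (by fun_prop)) (by fun_prop)]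
  have hcomp : (flatten m ∘ MeasurableEquiv.curry ℕ (Fin m) X) ∘
      MeasurableEquiv.piCongrLeft (fun _ => X) (Nat.divModEquiv m) = id := by
    ext y n
    have : (n / m, Fin.ofNat m n) = Nat.divModEquiv m n := rfl
    simp only [flatten, Function.comp_apply, MeasurableEquiv.coe_curry, Function.curry_apply, this,
      MeasurableEquiv.coe_piCongrLeft, Equiv.piCongrLeft_apply_apply, id]
  rw [hcomp, Measure.map_id]
  rfl

/-! ### Caps and slabs of the uniform distribution on the sphere -/

open scoped Pointwise in
-- The surface measure of `s` is `d` times the volume of the cone over `s`, so `sphereUniform` is a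
-- ratio of volumes and spherical estimates reduce to estimates in the ball.
theorem sphereUniform_le_of_cone_subset (d : ℕ) [NeZero d] {s : Set (SpherePt d)}
    (hs : MeasurableSet s) {T : Set (EuclideanSpace ℝ (Fin d))} {b : ℝ}
    (hT : ∀ x ∈ s, ∀ r : ℝ, 0 < r → r < 1 → r • (x : EuclideanSpace ℝ (Fin d)) ∈ T)
    (hb : volume T ≤ ENNReal.ofReal b * volume (Metric.ball (0 : EuclideanSpace ℝ (Fin d)) 1)) :
    sphereUniform d s ≤ ENNReal.ofReal b := by
  have hsub : Set.Ioo (0 : ℝ) 1 • ((↑) '' s : Set (EuclideanSpace ℝ (Fin d))) ⊆ T := by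
    rintro _ ⟨r, hr, _, ⟨x, hx, rfl⟩, rfl⟩
    exact hT x hx r hr.1 hr.2
  set V := volume (Metric.ball (0 : EuclideanSpace ℝ (Fin d)) 1) with hV
  have hV0 : V ≠ 0 := (Metric.measure_ball_pos _ _ one_pos).ne'
  have hVt : V ≠ ⊤ := measure_ball_lt_top.ne
  have hd0 : (d : ENNReal) ≠ 0 := by simpa using NeZero.ne d
  have hdt : (d : ENNReal) ≠ ⊤ := ENNReal.natCast_ne_top d
  simp only [sphereUniform, Measure.smul_apply, smul_eq_mul, Measure.toSphere_apply' _ hs,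
    Measure.toSphere_apply_univ, finrank_euclideanSpace, Fintype.card_fin, ← hV]
  calc ((d : ENNReal) * V)⁻¹ * (d * volume (Set.Ioo (0 : ℝ) 1 •
          ((↑) '' s : Set (EuclideanSpace ℝ (Fin d)))))
      ≤ ((d : ENNReal) * V)⁻¹ * (d * (ENNReal.ofReal b * V)) := by
        gcongr
        exact (measure_mono hsub).trans hb
    _ = ENNReal.ofReal b * (((d : ENNReal) * V)⁻¹ * (d * V)) := by ring
    _ = ENNReal.ofReal b := by
        rw [ENNReal.inv_mul_cancel (mul_ne_zero hd0 hV0) (ENNReal.mul_ne_top hdt hVt), mul_one]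

/-- A spherical cap at height `t` has measure at most `exp (-d t² / 2)`. -/
theorem sphereUniform_cap_le (d : ℕ) [NeZero d] {e : EuclideanSpace ℝ (Fin d)} (he : ‖e‖ = 1)
    {t : ℝ} (ht0 : 0 ≤ t) (ht : t ^ 2 ≤ 1 / 2) :
    sphereUniform d {x | t ≤ inner ℝ e (x : EuclideanSpace ℝ (Fin d))} ≤
      ENNReal.ofReal (Real.exp (-(d * t ^ 2 / 2))) := by
  refine sphereUniform_le_of_cone_subset d
    (measurableSet_le measurable_const (by fun_prop))
    (T := Metric.closedBall (t • e) (Real.exp (-(t ^ 2 / 2)))) ?_ ?_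
  · intro x hx r hr0 hr1
    have hx1 : ‖(x : EuclideanSpace ℝ (Fin d))‖ = 1 := by simp
    have hx' : t ≤ inner ℝ e (x : EuclideanSpace ℝ (Fin d)) := hx
    rw [Metric.mem_closedBall, dist_eq_norm]
    refine le_of_sq_le_sq ?_ (Real.exp_pos _).le
    have h1 : ‖r • (x : EuclideanSpace ℝ (Fin d)) - t • e‖ ^ 2 =
        r ^ 2 - 2 * (r * t * inner ℝ e (x : EuclideanSpace ℝ (Fin d))) + t ^ 2 := by
      rw [norm_sub_sq_real, norm_smul, norm_smul, hx1, he, inner_smul_left, inner_smul_right,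
        real_inner_comm]
      simp only [Real.norm_eq_abs, mul_one, sq_abs, RCLike.conj_to_real]
      ring
    have h2 : Real.exp (-(t ^ 2 / 2)) ^ 2 = Real.exp (-t ^ 2) := by
      rw [← Real.exp_nat_mul]; congr 1; push_cast; ring
    rw [h1, h2]
    have h3 := Real.add_one_le_exp (-t ^ 2)
    have h4 : r * t * t ≤ r * t * inner ℝ e (x : EuclideanSpace ℝ (Fin d)) :=
      mul_le_mul_of_nonneg_left hx' (by positivity)
    -- The claim is `r² - 2 r t² + t² ≤ 1 - t²`, that is, `(1 - r) (1 + r - 2 t²) ≥ 0`; this is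
    -- where `t² ≤ 1/2` enters.
    nlinarith [mul_nonneg (sub_nonneg.2 hr1.le) (by linarith : (0 : ℝ) ≤ r + 1 - 2 * t ^ 2)]
  · rw [Measure.addHaar_closedBall _ _ (Real.exp_pos _).le, finrank_euclideanSpace, Fintype.card_fin,
      ← Real.exp_nat_mul]
    gcongr
    apply le_of_eq; ring

open scoped Pointwise in
/-- The part of the unit ball in a slab of width `2 g` around a hyperplane through the center. -/
theorem volume_ball_slab_le (d : ℕ) [NeZero d] {u : EuclideanSpace ℝ (Fin d)} (hu : ‖u‖ = 1)
    {g : ℝ} (hg : 0 < g) :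
    volume {x : EuclideanSpace ℝ (Fin d) | ‖x‖ < 1 ∧ |inner ℝ u x| ≤ g} ≤
      ENNReal.ofReal (12 * g * √d) * volume (Metric.ball (0 : EuclideanSpace ℝ (Fin d)) 1) := by
  set T := {x : EuclideanSpace ℝ (Fin d) | ‖x‖ < 1 ∧ |inner ℝ u x| ≤ g} with hTdef
  have hTm : MeasurableSet T :=
    (measurableSet_lt measurable_norm measurable_const).inter
      (measurableSet_le (f := fun x : EuclideanSpace ℝ (Fin d) => |inner ℝ u x|)
        (by fun_prop) measurable_const)
  set V := volume (Metric.ball (0 : EuclideanSpace ℝ (Fin d)) 1) with hV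
  have hTV : volume T ≤ V := measure_mono fun x hx => by simpa using hx.1
  have hd1 : (1 : ℝ) ≤ d := by exact_mod_cast NeZero.one_le
  have hsd : 0 < √(d : ℝ) := by positivity
  have hsd2 : √(d : ℝ) ^ 2 = d := Real.sq_sqrt (by positivity)
  rcases le_or_gt 1 (12 * g * √d) with h1 | h1
  · calc volume T ≤ 1 * V := by rwa [one_mul]
      _ ≤ _ := by
        gcongr
        simpa using ENNReal.ofReal_le_ofReal h1
  -- Packing: copies of `T` shrunk by `ρ` and shifted by multiples of `3 g` along `u` are disjoint
  -- and remain in the unit ball. Shrinking costs at most a factor 2 in volume by Bernoulli, and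
  -- makes room for total shifts up to `1 / (2 √d)`, hence for at least `1 / (6 g √d)` copies.
  set ρ : ℝ := 1 - 1 / (2 * d) with hρ
  have hinv : (1 : ℝ) / d ≤ 1 := by rw [div_le_one (by positivity)]; exact hd1
  have hinv0 : (0 : ℝ) < 1 / d := by positivity
  have hρ' : ρ = 1 - 1 / d / 2 := by rw [hρ]; field_simp
  have hρ0 : 0 < ρ := by rw [hρ']; linarith
  have hρd : 1 / 2 ≤ ρ ^ d := by
    have h := one_add_mul_le_pow (a := -(1 / (2 * d : ℝ)))
      (by have : 1 / (2 * d : ℝ) = 1 / d / 2 := by field_simp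
          rw [this]; linarith) d
    have h2 : (1 : ℝ) + d * -(1 / (2 * d)) = 1 / 2 := by field_simp; norm_num
    rw [h2] at h
    simpa [hρ, sub_eq_add_neg] using h
  set N := ⌊1 / (6 * g * √d)⌋₊ + 1 with hN
  have hNge : 1 / (6 * g * √d) ≤ N := by
    rw [hN]; push_cast; exact (Nat.lt_floor_add_one _).le
  set A : ℕ → Set (EuclideanSpace ℝ (Fin d)) := fun i => ((3 * g * i) • u) +ᵥ (ρ • T) with hA
  have hAm : ∀ i, MeasurableSet (A i) := fun i => (hTm.const_smul₀ ρ).const_vadd _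
  have hAv : ∀ i, volume (A i) = ENNReal.ofReal (ρ ^ d) * volume T := fun i => by
    simp only [hA, measure_vadd, Measure.addHaar_smul, finrank_euclideanSpace, Fintype.card_fin]
    rw [abs_of_nonneg (by positivity)]
  have hAmem : ∀ i x, x ∈ A i → ∃ y ∈ T, x = (3 * g * i) • u + ρ • y := by
    rintro i x ⟨_, ⟨y, hy, rfl⟩, rfl⟩
    exact ⟨y, hy, rfl⟩
  have hin : ∀ (i : ℕ) y, y ∈ T → |inner ℝ u ((3 * g * i) • u + ρ • y) - 3 * g * i| ≤ g := by
    intro i y hy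
    rw [inner_add_right, inner_smul_right, inner_smul_right, real_inner_self_eq_norm_sq, hu]
    have : 3 * g * i * 1 ^ 2 + ρ * inner ℝ u y - 3 * g * i = ρ * inner ℝ u y := by ring
    rw [this, abs_mul, abs_of_pos hρ0]
    have hρ1 : ρ ≤ 1 := by rw [hρ']; linarith
    calc ρ * |inner ℝ u y| ≤ 1 * g := mul_le_mul hρ1 hy.2 (abs_nonneg _) zero_le_one
      _ = g := one_mul g
  have hdisj : Set.PairwiseDisjoint (↑(Finset.range N)) A := by
    intro i _ j _ hij
    refine Set.disjoint_left.2 fun x hxi hxj => ?_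
    obtain ⟨y, hy, hxy⟩ := hAmem i x hxi
    obtain ⟨z, hz, hxz⟩ := hAmem j x hxj
    have h1 := hin i y hy
    have h2 := hin j z hz
    rw [← hxy, abs_le] at h1
    rw [← hxz, abs_le] at h2
    rcases lt_or_gt_of_ne hij with h | h
    · have : (i : ℝ) + 1 ≤ j := by exact_mod_cast h
      nlinarith
    · have : (j : ℝ) + 1 ≤ i := by exact_mod_cast h
      nlinarith
  have hsub : (⋃ i ∈ Finset.range N, A i) ⊆ Metric.ball (0 : EuclideanSpace ℝ (Fin d)) 1 := by
    refine Set.iUnion₂_subset fun i hi x hx => ?_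
    obtain ⟨y, hy, rfl⟩ := hAmem i x hx
    rw [mem_ball_zero_iff]
    have hi' : (i : ℝ) ≤ 1 / (6 * g * √d) := by
      have : i ≤ ⌊1 / (6 * g * √d)⌋₊ := by have := Finset.mem_range.1 hi; omega
      exact (Nat.cast_le.2 this).trans (Nat.floor_le (by positivity))
    set s := 3 * g * i with hs
    have hs0 : 0 ≤ s := by positivity
    have hsle : s * √d ≤ 1 / 2 := by
      calc s * √d ≤ 3 * g * (1 / (6 * g * √d)) * √d := by rw [hs]; gcongr
        _ = 1 / 2 := by field_simp; norm_num
    have hss : s ^ 2 ≤ 1 / d / 4 := by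
      rw [div_div, le_div_iff₀ (by positivity)]
      nlinarith [mul_nonneg hs0 hsd.le]
    have hsg : s * g ≤ 1 / d / 24 := by
      rw [div_div, le_div_iff₀ (by positivity)]
      have h := mul_le_mul hsle h1.le (by positivity) (by norm_num)
      have h' : s * √d * (12 * g * √d) = 12 * (s * g * √(d : ℝ) ^ 2) := by ring
      rw [h', hsd2] at h
      linarith
    have h1 : ‖s • u + ρ • y‖ ^ 2 = s ^ 2 + 2 * (s * (ρ * inner ℝ u y)) + ρ ^ 2 * ‖y‖ ^ 2 := by
      rw [norm_add_sq_real, norm_smul, norm_smul, hu, inner_smul_left, inner_smul_right]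
      simp only [Real.norm_eq_abs, mul_one, sq_abs, RCLike.conj_to_real, mul_pow]
    have hy2 : ρ * inner ℝ u y ≤ g := by
      have h := hin i y hy
      rw [inner_add_right, inner_smul_right, inner_smul_right, real_inner_self_eq_norm_sq, hu] at h
      have := (abs_le.1 h).2
      linarith
    have hyn : ‖y‖ ^ 2 ≤ 1 := by
      have := hy.1; have h0 := norm_nonneg y; nlinarith
    have h2 : ‖s • u + ρ • y‖ ^ 2 < 1 := by
      rw [h1]
      have ha : s * (ρ * inner ℝ u y) ≤ s * g := mul_le_mul_of_nonneg_left hy2 hs0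
      have hb : ρ ^ 2 * ‖y‖ ^ 2 ≤ ρ ^ 2 := by nlinarith [sq_nonneg ρ]
      have hc : ρ ^ 2 ≤ 1 - 3 / 4 * (1 / d) := by rw [hρ']; nlinarith
      linarith
    nlinarith [norm_nonneg (s • u + ρ • y)]
  have hsum : (N : ENNReal) * (ENNReal.ofReal (ρ ^ d) * volume T) ≤ V := by
    calc _ = ∑ i ∈ Finset.range N, volume (A i) := by simp [hAv]
      _ = volume (⋃ i ∈ Finset.range N, A i) :=
        (measure_biUnion_finset hdisj fun i _ => hAm i).symm
      _ ≤ V := measure_mono hsub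
  calc volume T = ENNReal.ofReal (12 * g * √d) * (ENNReal.ofReal (1 / (6 * g * √d)) *
          (ENNReal.ofReal (1 / 2) * volume T)) := by
        rw [← mul_assoc, ← mul_assoc, ← ENNReal.ofReal_mul (by positivity),
          ← ENNReal.ofReal_mul (by positivity)]
        have : 12 * g * √d * (1 / (6 * g * √d)) * (1 / 2) = 1 := by field_simp; norm_num
        rw [this]; simp
    _ ≤ ENNReal.ofReal (12 * g * √d) * (N * (ENNReal.ofReal (ρ ^ d) * volume T)) := by
        gcongr
        rw [← ENNReal.ofReal_natCast]
        exact ENNReal.ofReal_le_ofReal hNge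
    _ ≤ _ := by gcongr

/-- The uniform distribution on the sphere does not concentrate around a great subsphere. -/
theorem sphereUniform_slab_le (d : ℕ) [NeZero d] {u : EuclideanSpace ℝ (Fin d)} (hu : ‖u‖ = 1)
    {g : ℝ} (hg : 0 < g) :
    sphereUniform d {x | |inner ℝ u (x : EuclideanSpace ℝ (Fin d))| ≤ g} ≤
      ENNReal.ofReal (12 * g * √d) := by
  refine sphereUniform_le_of_cone_subset d
    (measurableSet_le (by fun_prop) measurable_const) ?_ (volume_ball_slab_le d hu hg)
  intro x hx r hr0 hr1
  have hx' : |inner ℝ u (x : EuclideanSpace ℝ (Fin d))| ≤ g := hx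
  refine ⟨by simp [norm_smul, abs_of_pos hr0, hr1], ?_⟩
  rw [inner_smul_right, abs_mul, abs_of_pos hr0]
  nlinarith [abs_nonneg (inner ℝ u (x : EuclideanSpace ℝ (Fin d)))]

/-- Two-sided tail bound for the inner product with a vector of norm at most `s - 1`. -/
theorem sphereUniform_abs_inner_ge_le (d : ℕ) [NeZero d] {v : EuclideanSpace ℝ (Fin d)} {s : ℕ}
    (hv : ‖v‖ + 1 ≤ s) {η : ℝ} (hη0 : 0 ≤ η) (hη : 2 ≤ s → Real.exp (-(d / (2 * s ^ 2))) ≤ η) :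
    sphereUniform d {x | 1 ≤ |inner ℝ v (x : EuclideanSpace ℝ (Fin d))|} ≤
      ENNReal.ofReal (2 * η) := by
  -- For `s = 1` the displacement is zero and nothing is asked of `η`; the parameter choice relies
  -- on this when `d` is small compared with the logarithm.
  by_cases hv0 : v = 0
  · have : {x : SpherePt d | 1 ≤ |inner ℝ v (x : EuclideanSpace ℝ (Fin d))|} = ∅ := by
      ext x; simp [hv0]
    simp [this]
  have hvp : 0 < ‖v‖ := norm_pos_iff.2 hv0
  have hs2 : 2 ≤ s := by
    have : (1 : ℝ) < s := by linarith
    have : 1 < s := by exact_mod_cast this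
    omega
  have hs2' : (2 : ℝ) ≤ s := by exact_mod_cast hs2
  have hone : ∀ e : EuclideanSpace ℝ (Fin d), ‖e‖ = 1 →
      sphereUniform d {x | (1 / s : ℝ) ≤ inner ℝ e (x : EuclideanSpace ℝ (Fin d))} ≤
        ENNReal.ofReal η := fun e he => by
    refine (sphereUniform_cap_le d he (by positivity) ?_).trans (ENNReal.ofReal_le_ofReal ?_)
    · rw [div_pow, one_pow]
      gcongr
      nlinarith
    · convert hη hs2 using 2
      field_simp
  set e := ‖v‖⁻¹ • v with he
  have he1 : ‖e‖ = 1 := norm_smul_inv_norm hv0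
  have hve : v = ‖v‖ • e := by rw [he, smul_smul, mul_inv_cancel₀ hvp.ne', one_smul]
  have hsub : {x : SpherePt d | 1 ≤ |inner ℝ v (x : EuclideanSpace ℝ (Fin d))|} ⊆
      {x | (1 / s : ℝ) ≤ inner ℝ e (x : EuclideanSpace ℝ (Fin d))} ∪
      {x | (1 / s : ℝ) ≤ inner ℝ (-e) (x : EuclideanSpace ℝ (Fin d))} := by
    intro x hx
    have hx' : 1 ≤ |inner ℝ v (x : EuclideanSpace ℝ (Fin d))| := hx
    rw [hve, inner_smul_left, abs_mul] at hx'
    simp only [RCLike.conj_to_real, abs_norm] at hx'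
    have h1 : (1 / s : ℝ) ≤ |inner ℝ e (x : EuclideanSpace ℝ (Fin d))| := by
      rw [div_le_iff₀ (by positivity)]
      nlinarith [abs_nonneg (inner ℝ e (x : EuclideanSpace ℝ (Fin d)))]
    rcases le_abs.1 h1 with h | h
    · exact Or.inl h
    · exact Or.inr (by simpa [inner_neg_left] using h)
  calc _ ≤ _ := measure_mono hsub
    _ ≤ _ := measure_union_le _ _
    _ ≤ ENNReal.ofReal η + ENNReal.ofReal η :=
        add_le_add (hone e he1) (hone (-e) (by rwa [norm_neg]))
    _ = _ := by rw [← ENNReal.ofReal_add hη0 hη0]; congr 1; ring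

/-! ### The Perceptron as a process indexed by single draws -/

/-- A drawn point with its coin, labeled by the target separator. -/
def labeled {d : ℕ} (ws : EuclideanSpace ℝ (Fin d)) (y : SpherePt d × unitInterval) : Draw d :=
  ⟨y.1, sepLabel ws y.1, y.2⟩

/-- The hypothesis after `n` draws, when the draws of all players are read one after the other and
a pass consists of `N` draws. -/
def hypAfter {d : ℕ} (N : ℕ) (β : unitInterval) (ws : EuclideanSpace ℝ (Fin d))
    (y : ℕ → SpherePt d × unitInterval) : ℕ → EuclideanSpace ℝ (Fin d)
  | 0 => 0
  | n + 1 =>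
    if n / N % 2 = 0 then hypAfter N β ws y n
    else marginStep β (hypAfter N β ws y n) (labeled ws (y n))

open Classical in
/-- The number of draws of the `q`-th test pass on which the hypothesis errs. -/
def testCount {d : ℕ} (N : ℕ) (β : unitInterval) (ws : EuclideanSpace ℝ (Fin d))
    (y : ℕ → SpherePt d × unitInterval) (q : ℕ) : ℕ :=
  ∑ i ∈ Finset.range N,
    if (labeled ws (y (2 * q * N + i))).margin (hypAfter N β ws y (2 * q * N)) ≤ 0 then 1 else 0

open Classical in
/-- Whether the draw `n` leads to an update of the hypothesis. -/
def updated {d : ℕ} (N : ℕ) (β : unitInterval) (ws : EuclideanSpace ℝ (Fin d))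
    (y : ℕ → SpherePt d × unitInterval) (n : ℕ) : ℕ :=
  if n / N % 2 ≠ 0 ∧ (y n).2 < β ∧ (labeled ws (y n)).margin (hypAfter N β ws y n) < 1 then 1 else 0

open Classical in
/-- Whether the draw `n` is selected in an update pass and is within `γ` of the boundary of the
target. -/
def smallMargin {d : ℕ} (N : ℕ) (β : unitInterval) (ws : EuclideanSpace ℝ (Fin d)) (γ : ℝ)
    (y : ℕ → SpherePt d × unitInterval) (n : ℕ) : ℕ :=
  if n / N % 2 ≠ 0 ∧ (y n).2 < β ∧ |inner ℝ ws ((y n).1 : EuclideanSpace ℝ (Fin d))| ≤ γ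
    then 1 else 0

theorem foldl_ofFn_eq {α β : Type*} (f : β → α → β) {m : ℕ} (S : Fin m → α) (g : ℕ → β)
    (hg : ∀ j : Fin m, g (j + 1) = f (g j) (S j)) : (List.ofFn S).foldl f (g 0) = g m := by
  induction m generalizing g with
  | zero => simp
  | succ m ih =>
    rw [List.ofFn_succ, List.foldl_cons]
    have h0 := hg 0
    simp only [Fin.val_zero, zero_add] at h0
    rw [← h0]
    exact ih (fun i => S i.succ) (fun j => g (j + 1)) fun j => by simpa using hg j.succ

section SequentialRun

variable {d : ℕ} (N : ℕ) (β : unitInterval) (ws : EuclideanSpace ℝ (Fin d))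
  (y : ℕ → SpherePt d × unitInterval)

/-- Adaptedness, in the form that the resampling lemmas require: the hypothesis ignores draws not
yet made. -/
theorem hypAfter_update {n j : ℕ} (h : n ≤ j) (z : SpherePt d × unitInterval) :
    hypAfter N β ws (Function.update y j z) n = hypAfter N β ws y n := by
  induction n with
  | zero => rfl
  | succ n ih =>
    have hne : n ≠ j := by omega
    simp only [hypAfter, ih (by omega), Function.update_of_ne hne]

theorem abs_sepLabel (x : SpherePt d) : |sepLabel ws x| = 1 := by
  unfold sepLabel; split_ifs <;> simp

theorem sepLabel_mul_inner (x : SpherePt d) :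
    sepLabel ws x * inner ℝ ws (x : EuclideanSpace ℝ (Fin d)) =
      |inner ℝ ws (x : EuclideanSpace ℝ (Fin d))| := by
  unfold sepLabel
  split_ifs with h
  · rw [one_mul, abs_of_nonneg h]
  · rw [abs_of_neg (not_le.1 h)]; ring

theorem measurable_sepLabel : Measurable (sepLabel ws) :=
  Measurable.ite (measurableSet_le measurable_const (by fun_prop)) measurable_const measurable_const

theorem measurable_margin :
    Measurable fun p : EuclideanSpace ℝ (Fin d) × (SpherePt d × unitInterval) =>
      (labeled ws p.2).margin p.1 := by
  have h := (measurable_sepLabel ws).comp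
    (measurable_fst.comp (measurable_snd :
      Measurable fun p : EuclideanSpace ℝ (Fin d) × (SpherePt d × unitInterval) => p.2))
  unfold labeled Draw.margin
  refine h.mul ?_
  fun_prop

theorem measurable_hypAfter (n : ℕ) :
    Measurable fun y : ℕ → SpherePt d × unitInterval => hypAfter N β ws y n := by
  induction n with
  | zero => exact measurable_const
  | succ n ih =>
    simp only [hypAfter]
    split_ifs
    · exact ih
    · unfold marginStep
      have hp : Measurable fun y : ℕ → SpherePt d × unitInterval => (hypAfter N β ws y n, y n) :=
        ih.prodMk (measurable_pi_apply n)
      refine Measurable.ite ?_ (ih.add ?_) ih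
      · refine MeasurableSet.inter (measurableSet_lt (f := fun y : ℕ → SpherePt d × unitInterval =>
          (y n).2) (by fun_prop) measurable_const)
          (measurableSet_lt ((measurable_margin ws).comp hp) measurable_const)
      · simp only [labeled]
        exact ((measurable_sepLabel ws).comp (measurable_fst.comp (measurable_pi_apply n))).smul
          (by fun_prop)

/-- The 0/1 indicator merges test and update passes into one recursion, on which the potential
arguments run. -/
theorem hypAfter_succ (n : ℕ) : hypAfter N β ws y (n + 1) = hypAfter N β ws y n +
    (updated N β ws y n : ℝ) • (sepLabel ws (y n).1 • ((y n).1 : EuclideanSpace ℝ (Fin d))) := by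
  by_cases h : n / N % 2 = 0
  · simp [hypAfter, updated, h]
  · simp only [hypAfter, updated, h, if_false, ne_eq, not_false_eq_true, true_and, marginStep]
    by_cases hc : (y n).2 < β ∧ (labeled ws (y n)).margin (hypAfter N β ws y n) < 1
    · rw [if_pos hc, if_pos (show (labeled ws (y n)).coin < β ∧ _ from hc)]; simp [labeled]
    · rw [if_neg hc, if_neg (show ¬ ((labeled ws (y n)).coin < β ∧ _) from hc)]; simp

theorem updated_eq_zero_or {n : ℕ} : updated N β ws y n = 0 ∨
    updated N β ws y n = 1 ∧ n / N % 2 ≠ 0 ∧ (y n).2 < β ∧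
      (labeled ws (y n)).margin (hypAfter N β ws y n) < 1 := by
  unfold updated; split_ifs with h
  · exact Or.inr ⟨rfl, h⟩
  · exact Or.inl rfl

/-- The squared norm of the hypothesis grows by at most `3` in each update. -/
theorem norm_sq_hypAfter_le (n : ℕ) : ‖hypAfter N β ws y n‖ ^ 2 ≤
    3 * ∑ j ∈ Finset.range n, (updated N β ws y j : ℝ) := by
  induction n with
  | zero => simp [hypAfter]
  | succ n ih =>
    rw [Finset.sum_range_succ, hypAfter_succ]
    rcases updated_eq_zero_or N β ws y (n := n) with h | ⟨h, -, -, hm⟩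
    · simpa [h] using ih
    · have h1 : inner ℝ (hypAfter N β ws y n)
          (sepLabel ws (y n).1 • ((y n).1 : EuclideanSpace ℝ (Fin d))) < 1 := by
        rw [inner_smul_right]; exact hm
      have h2 : ‖sepLabel ws (y n).1 • ((y n).1 : EuclideanSpace ℝ (Fin d))‖ = 1 := by
        rw [norm_smul, Real.norm_eq_abs, abs_sepLabel]; simp
      rw [h, Nat.cast_one, one_smul, norm_add_sq_real, h2]
      linarith

/-- Each update with margin at least `γ` makes progress `γ` in the direction of the target. -/
theorem le_inner_hypAfter {γ : ℝ} (hγ : 0 ≤ γ) (n : ℕ) :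
    γ * (∑ j ∈ Finset.range n, (updated N β ws y j : ℝ) -
      ∑ j ∈ Finset.range n, (smallMargin N β ws γ y j : ℝ)) ≤
      inner ℝ ws (hypAfter N β ws y n) := by
  induction n with
  | zero => simp [hypAfter]
  | succ n ih =>
    rw [Finset.sum_range_succ, Finset.sum_range_succ, hypAfter_succ, inner_add_right,
      inner_smul_right, inner_smul_right, sepLabel_mul_inner]
    have habs := abs_nonneg (inner ℝ ws ((y n).1 : EuclideanSpace ℝ (Fin d)))
    rcases updated_eq_zero_or N β ws y (n := n) with h | ⟨h, h1, h2, -⟩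
    · rw [h]
      have : (0 : ℝ) ≤ γ * smallMargin N β ws γ y n := by positivity
      simp only [Nat.cast_zero, zero_mul, add_zero]
      linarith
    · rw [h]
      -- A near-boundary update still makes nonnegative progress, since the target labels it
      -- consistently; the bound credits it with zero. `smallMargin` may also count examples that
      -- cause no update, which only weakens the bound and keeps the count independent of the
      -- hypothesis.
      by_cases hs : |inner ℝ ws ((y n).1 : EuclideanSpace ℝ (Fin d))| ≤ γ
      · have : smallMargin N β ws γ y n = 1 := if_pos ⟨h1, h2, hs⟩
        rw [this]; push_cast; linarith
      · have : smallMargin N β ws γ y n = 0 := if_neg fun h => hs h.2.2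
        rw [this]; push_cast; linarith

theorem norm_hypAfter_sub_le (n l : ℕ) : ‖hypAfter N β ws y (n + l) - hypAfter N β ws y n‖ ≤
    ∑ j ∈ Finset.range l, (updated N β ws y (n + j) : ℝ) := by
  induction l with
  | zero => simp
  | succ l ih =>
    rw [Finset.sum_range_succ, ← add_assoc, hypAfter_succ, add_sub_right_comm]
    refine (norm_add_le _ _).trans (add_le_add ih ?_)
    rw [norm_smul, norm_smul, Real.norm_eq_abs (sepLabel _ _), abs_sepLabel]
    simp

theorem hypAfter_testPass {q : ℕ} (i : ℕ) (hi : i ≤ N) :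
    hypAfter N β ws y (2 * q * N + i) = hypAfter N β ws y (2 * q * N) := by
  induction i with
  | zero => rfl
  | succ i ih =>
    have hN : 0 < N := by omega
    have hdiv : (2 * q * N + i) / N % 2 = 0 := by
      rw [mul_comm (2 * q) N, Nat.mul_add_div hN, Nat.div_eq_of_lt (by omega)]; omega
    rw [← add_assoc, hypAfter, if_pos hdiv, ih (by omega)]

end SequentialRun

/-! ### Translating the protocol into the sequential process -/

section Transcript

variable {d k m : ℕ} [NeZero k] [NeZero m] (β : unitInterval) (ws : EuclideanSpace ℝ (Fin d))
  (ω : ℕ → Fin m → SpherePt d × unitInterval)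

theorem flatten_mul_add {X : Type*} (ω : ℕ → Fin m → X) (t : ℕ) (j : Fin m) :
    flatten m ω (t * m + j) = ω t j := by
  have hm : 0 < m := Nat.pos_of_ne_zero (NeZero.ne m)
  unfold flatten
  have h1 : (t * m + j) / m = t := by
    rw [mul_comm, Nat.mul_add_div hm, Nat.div_eq_of_lt j.2, add_zero]
  have h2 : Fin.ofNat m (t * m + j) = j := by
    ext
    simp [Fin.ofNat, Nat.mod_eq_of_lt j.2]
  rw [h1, h2]

theorem transcript_hyp (t : ℕ) : (transcript k m β (labelDraws ws ω) t).hyp =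
    hypAfter (k * m) β ws (flatten m ω) (t * m) := by
  have hm : 0 < m := Nat.pos_of_ne_zero (NeZero.ne m)
  have hk : 0 < k := Nat.pos_of_ne_zero (NeZero.ne k)
  induction t with
  | zero => simp [transcript, hypAfter]
  | succ t ih =>
    have hdiv : ∀ j < m, (t * m + j) / (k * m) = t / k := fun j hj => by
      rw [mul_comm k m, ← Nat.div_div_eq_div_mul, mul_comm t m, Nat.mul_add_div hm,
        Nat.div_eq_of_lt hj, add_zero]
    rw [transcript, add_mul, one_mul]
    split_ifs with h
    · have hc : ∀ j ≤ m, hypAfter (k * m) β ws (flatten m ω) (t * m + j) =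
          hypAfter (k * m) β ws (flatten m ω) (t * m) := by
        intro j hj
        induction j with
        | zero => rfl
        | succ j ihj => rw [← add_assoc, hypAfter, hdiv j (by omega), if_pos h, ihj (by omega)]
      rw [hc m le_rfl, ← ih]
      rfl
    · simp only [updateTurn, ih]
      refine foldl_ofFn_eq (marginStep β) (labelDraws ws ω t)
        (fun j => hypAfter (k * m) β ws (flatten m ω) (t * m + j)) fun j => ?_
      rw [← add_assoc, hypAfter, hdiv j j.2, if_neg h, flatten_mul_add]
      rfl

theorem transcript_count (q : ℕ) : (transcript k m β (labelDraws ws ω) (2 * q * k + k)).count =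
    testCount (k * m) β ws (flatten m ω) q := by
  classical
  have hm : 0 < m := Nat.pos_of_ne_zero (NeZero.ne m)
  have hk : 0 < k := Nat.pos_of_ne_zero (NeZero.ne k)
  -- Before a test pass comes either the initial message or an update turn, which resets the
  -- counter.
  have hstart : (transcript k m β (labelDraws ws ω) (2 * q * k)).count = 0 := by
    rcases Nat.eq_zero_or_pos q with rfl | hq
    · simp [transcript]
    · obtain ⟨s, hs⟩ : ∃ s, 2 * q * k = s + 1 :=
        ⟨2 * q * k - 1, by have : 0 < 2 * q * k := by positivity
                           omega⟩
      have hdiv : s / k = 2 * q - 1 := by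
        rw [Nat.div_eq_iff hk, Nat.sub_mul, Nat.one_mul]
        have : k ≤ 2 * q * k := Nat.le_mul_of_pos_left k (by omega)
        omega
      rw [hs, transcript, if_neg (by rw [hdiv]; omega)]
      rfl
  have key : ∀ r ≤ k, (transcript k m β (labelDraws ws ω) (2 * q * k + r)).count =
      ∑ i ∈ Finset.range (r * m), if (labeled ws (flatten m ω (2 * q * (k * m) + i))).margin
        (hypAfter (k * m) β ws (flatten m ω) (2 * q * (k * m))) ≤ 0 then 1 else 0 := by
    intro r hr
    induction r with
    | zero => simpa using hstart
    | succ r ih =>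
      have hdiv : (2 * q * k + r) / k % 2 = 0 := by
        rw [mul_comm (2 * q) k, Nat.mul_add_div hk, Nat.div_eq_of_lt (by omega)]; omega
      have hh : (transcript k m β (labelDraws ws ω) (2 * q * k + r)).hyp =
          hypAfter (k * m) β ws (flatten m ω) (2 * q * (k * m)) := by
        rw [transcript_hyp, show (2 * q * k + r) * m = 2 * q * (k * m) + r * m by ring,
          hypAfter_testPass]
        exact Nat.mul_le_mul_right m (by omega)
      rw [← add_assoc, transcript, if_pos hdiv, testTurn, ih (by omega), hh, Finset.card_filter,
        add_mul, one_mul, Finset.sum_range_add]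
      refine congrArg₂ (· + ·) rfl ?_
      rw [← Fin.sum_univ_eq_sum_range (fun j => if (labeled ws (flatten m ω
        (2 * q * (k * m) + (r * m + j)))).margin
        (hypAfter (k * m) β ws (flatten m ω) (2 * q * (k * m))) ≤ 0 then (1 : ℕ) else 0)]
      refine Finset.sum_congr rfl fun j _ => ?_
      rw [show 2 * q * (k * m) + (r * m + j) = (2 * q * k + r) * m + j by ring, flatten_mul_add]
      rfl
  exact key k le_rfl

/-- If some test pass is passed, and only hypotheses of small error pass the test, then the run
learns. -/
theorem learnsWithin_of_testCount {ε : ℝ} {Q : ℕ} {D : Measure (SpherePt d)}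
    (hex : ∃ q < Q, (testCount (k * m) β ws (flatten m ω) q : ℝ) ≤ ε / 2 * (k * m))
    (hgood : ∀ q < Q, (testCount (k * m) β ws (flatten m ω) q : ℝ) ≤ ε / 2 * (k * m) →
      sepError D ws (hypAfter (k * m) β ws (flatten m ω) (2 * q * (k * m))) ≤ ENNReal.ofReal ε) :
    LearnsWithin k m β ε (2 * k * Q) D ws (labelDraws ws ω) := by
  classical
  have hk : 0 < k := Nat.pos_of_ne_zero (NeZero.ne k)
  obtain ⟨q, hqQ, hq⟩ := hex
  have hStopsAt : StopsAt k m β ε (labelDraws ws ω) (2 * q * k + k) := by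
    refine ⟨?_, by rwa [transcript_count]⟩
    rw [show 2 * q * k + k = k + 2 * k * q by ring, Nat.add_mul_mod_self_left,
      Nat.mod_eq_of_lt (by omega)]
  have hexs : ∃ t, StopsAt k m β ε (labelDraws ws ω) t := ⟨_, hStopsAt⟩
  -- The first stop may come before `q`, but it too ends a test pass `q' ≤ q`, so `hgood` covers it.
  set t := Nat.find hexs with ht
  have htq : t ≤ 2 * q * k + k := Nat.find_min' hexs hStopsAt
  have hts : StopsAt k m β ε (labelDraws ws ω) t := Nat.find_spec hexs
  obtain ⟨q', hq'⟩ : ∃ q', t = 2 * q' * k + k := by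
    refine ⟨t / (2 * k), ?_⟩
    have := Nat.div_add_mod t (2 * k)
    rw [hts.1] at this
    rw [← this]; congr 1
    rw [this]; ring
  have hq'q : q' ≤ q := by
    by_contra hlt
    have h1 : q + 1 ≤ q' := by omega
    have h2 : 2 * (q + 1) * k ≤ 2 * q' * k := by gcongr
    have h3 : 2 * (q + 1) * k = 2 * q * k + 2 * k := by ring
    omega
  refine ⟨t, ?_, hts, fun s hs => Nat.find_min hexs hs, ?_⟩
  · have h2 : 2 * (q + 1) * k ≤ 2 * Q * k := by gcongr; omega
    have h3 : 2 * (q + 1) * k = 2 * q * k + 2 * k := by ring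
    have h4 : 2 * k * Q = 2 * Q * k := by ring
    omega
  · have h1 := hgood q' (by omega) (by
      have := hts.2
      rwa [hq', transcript_count] at this)
    rw [transcript_hyp, hq', show (2 * q' * k + k) * m = 2 * q' * (k * m) + k * m by ring,
      hypAfter_testPass _ _ _ _ _ le_rfl]
    exact h1

end Transcript

/-! ### Tail bounds with explicit constants -/

open Classical in
/-- Lower tail of the number of coordinates in a block whose value is in `S`. -/
theorem measure_block_count_le_half {X α : Type*} [MeasurableSpace X]
    [MeasurableSpace α] (μ : ℕ → Measure X) [∀ i, IsProbabilityMeasure (μ i)] (n₀ : ℕ)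
    {f : (ℕ → X) → α} (hf : Measurable f)
    (hfn : ∀ n y z, n₀ ≤ n → f (Function.update y n z) = f y)
    {S : Set (α × X)} (hS : MeasurableSet S) {G : Set α} (hG : MeasurableSet G) (l : ℕ)
    {M : ℝ} (hM : 0 ≤ M)
    (hb : ∀ a ∈ G, M ≤ ∑ j ∈ Finset.range l, (μ (n₀ + j)).real {z | (a, z) ∈ S}) :
    Measure.infinitePi μ {y | f y ∈ G ∧
        ((∑ j ∈ Finset.range l, if (f y, y (n₀ + j)) ∈ S then 1 else 0 : ℕ) : ℝ) ≤ M / 2} ≤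
      ENNReal.ofReal (Real.exp (-(M / 10))) := by
  have h := measure_block_count_le μ n₀ hf hfn hS hG l (lam := 1 / 2) (b := -(M / 2))
    (θ := Real.exp (-(Real.log 2 * (M / 2)))) (by norm_num)
    (fun a ha => by have := hb a ha; linarith) (Real.exp_pos _)
  refine le_trans (measure_mono ?_) (h.trans (ENNReal.ofReal_le_ofReal ?_))
  · rintro y ⟨h1, h2⟩
    refine ⟨h1, ?_⟩
    set n : ℕ := ∑ j ∈ Finset.range l, if (f y, y (n₀ + j)) ∈ S then 1 else 0
    have : ((1 : ℝ) / 2) ^ n = Real.exp (-(Real.log 2 * n)) := by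
      rw [Real.exp_neg, mul_comm, Real.exp_nat_mul, Real.exp_log two_pos, one_div, inv_pow]
    rw [this, Real.exp_le_exp]
    have := Real.log_pos one_lt_two
    nlinarith
  -- The exponent is `-(1 - log 2) M / 2`, about `-0.153 M`.
  · rw [← Real.exp_sub, Real.exp_le_exp]
    have := Real.log_two_lt_d9
    nlinarith

open Classical in
/-- Upper tail of the number of coordinates in a block whose value is in `S`. -/
theorem measure_block_count_ge_two_mul {X α : Type*} [MeasurableSpace X]
    [MeasurableSpace α] (μ : ℕ → Measure X) [∀ i, IsProbabilityMeasure (μ i)] (n₀ : ℕ)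
    {f : (ℕ → X) → α} (hf : Measurable f)
    (hfn : ∀ n y z, n₀ ≤ n → f (Function.update y n z) = f y)
    {S : Set (α × X)} (hS : MeasurableSet S) {G : Set α} (hG : MeasurableSet G) (l : ℕ)
    {M : ℝ} (hM : 0 ≤ M)
    (hb : ∀ a ∈ G, ∑ j ∈ Finset.range l, (μ (n₀ + j)).real {z | (a, z) ∈ S} ≤ M) :
    Measure.infinitePi μ {y | f y ∈ G ∧
        2 * M ≤ ((∑ j ∈ Finset.range l, if (f y, y (n₀ + j)) ∈ S then 1 else 0 : ℕ) : ℝ)} ≤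
      ENNReal.ofReal (Real.exp (-(M / 10))) := by
  have h := measure_block_count_le μ n₀ hf hfn hS hG l (lam := 2) (b := M)
    (θ := Real.exp (Real.log 2 * (2 * M))) (by norm_num)
    (fun a ha => by have := hb a ha; linarith) (Real.exp_pos _)
  refine le_trans (measure_mono ?_) (h.trans (ENNReal.ofReal_le_ofReal ?_))
  · rintro y ⟨h1, h2⟩
    refine ⟨h1, ?_⟩
    set n : ℕ := ∑ j ∈ Finset.range l, if (f y, y (n₀ + j)) ∈ S then 1 else 0
    have : (2 : ℝ) ^ n = Real.exp (Real.log 2 * n) := by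
      rw [mul_comm, Real.exp_nat_mul, Real.exp_log two_pos]
    rw [this, Real.exp_le_exp]
    have := Real.log_pos one_lt_two
    nlinarith
  -- The exponent is `-(2 log 2 - 1) M`, about `-0.386 M`.
  · rw [← Real.exp_sub, Real.exp_le_exp]
    have := Real.log_two_gt_d9
    nlinarith

open Classical in
/-- Markov's inequality for the number of events that occur. -/
theorem measure_count_events_ge_le {Ω ι : Type*} [MeasurableSpace Ω] (P : Measure Ω)
    (s : Finset ι) {E : ι → Set Ω} (hE : ∀ i ∈ s, MeasurableSet (E i)) {a b : ℝ} (ha : 0 < a)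
    (hb : ∑ i ∈ s, P (E i) ≤ ENNReal.ofReal b) :
    P {ω | a ≤ ((∑ i ∈ s, if ω ∈ E i then 1 else 0 : ℕ) : ℝ)} ≤ ENNReal.ofReal (b / a) := by
  have hint : ∫⁻ ω, ∑ i ∈ s, (E i).indicator 1 ω ∂P = ∑ i ∈ s, P (E i) := by
    rw [lintegral_finsetSum' _ fun i hi => (measurable_one.indicator (hE i hi)).aemeasurable]
    exact Finset.sum_congr rfl fun i hi => lintegral_indicator_one (hE i hi)
  have hm : Measurable fun ω => ∑ i ∈ s, (E i).indicator (1 : Ω → ENNReal) ω :=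
    Finset.measurable_sum _ fun i hi => measurable_one.indicator (hE i hi)
  have h := meas_ge_le_lintegral_div (μ := P) hm.aemeasurable (ε := ENNReal.ofReal a)
    (by simpa using ha) (by simp)
  rw [hint] at h
  refine le_trans (measure_mono ?_) (h.trans ?_)
  · intro ω hω
    have h1 : a ≤ ((∑ i ∈ s, if ω ∈ E i then 1 else 0 : ℕ) : ℝ) := hω
    have h2 : ∑ i ∈ s, (E i).indicator (1 : Ω → ENNReal) ω =
        ((∑ i ∈ s, if ω ∈ E i then 1 else 0 : ℕ) : ENNReal) := by
      push_cast
      exact Finset.sum_congr rfl fun i _ => by simp [Set.indicator_apply]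
    simp only [Set.mem_ofPred_eq, h2]
    rw [← ENNReal.ofReal_natCast]
    exact ENNReal.ofReal_le_ofReal h1
  · rw [ENNReal.ofReal_div_of_pos ha]
    gcongr

/-! ### The mixture and the laws of single draws -/

theorem NonConcentrated.apply_le {c : ℝ} {D : Measure (SpherePt d)} (h : NonConcentrated c D)
    {A : Set (SpherePt d)} (hA : MeasurableSet A) :
    D A ≤ ENNReal.ofReal c * sphereUniform d A := by
  obtain ⟨p, -, hp, rfl⟩ := h
  rw [withDensity_apply _ hA]
  calc _ ≤ ∫⁻ _ in A, ENNReal.ofReal c ∂(sphereUniform d) := lintegral_mono fun x => hp x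
    _ = _ := by simp

/-- A pass is `k` consecutive rounds starting at a multiple of `k`, so each player contributes
exactly `m` draws to it. -/
theorem sum_range_pass {k : ℕ} [NeZero k] (m : ℕ) [NeZero m] (p : ℕ) (f : Fin k → ℝ) :
    ∑ j ∈ Finset.range (k * m), f (Fin.ofNat k ((p * (k * m) + j) / m)) = m * ∑ i, f i := by
  have hm : 0 < m := Nat.pos_of_ne_zero (NeZero.ne m)
  have h1 : ∀ j, Fin.ofNat k ((p * (k * m) + j) / m) = Fin.ofNat k (j / m) := fun j => by
    rw [show p * (k * m) + j = m * (k * p) + j by ring, Nat.mul_add_div hm]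
    ext
    simp [Fin.ofNat]
  have h2 : ∀ (g : ℕ → ℝ) (a : ℕ), ∑ j ∈ Finset.range (a * m), g (j / m) =
      m * ∑ t ∈ Finset.range a, g t := by
    intro g a
    induction a with
    | zero => simp
    | succ a ih =>
      rw [add_mul, one_mul, Finset.sum_range_add, ih, Finset.sum_range_succ, mul_add]
      congr 1
      rw [Finset.sum_congr rfl fun j hj => by
        rw [mul_comm a m, Nat.mul_add_div hm, Nat.div_eq_of_lt (Finset.mem_range.1 hj), add_zero]]
      simp
  simp only [h1]
  rw [h2 (fun t => f (Fin.ofNat k t)) k, Finset.sum_range]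
  congr 1
  refine Finset.sum_congr rfl fun i _ => ?_
  congr 1
  ext
  simp [Fin.ofNat, Nat.mod_eq_of_lt i.2]

section Mixture

variable {d k : ℕ} (D : Fin k → Measure (SpherePt d))

theorem mixture_apply (A : Set (SpherePt d)) :
    mixture D A = (k : ENNReal)⁻¹ * ∑ i, D i A := by
  simp [mixture]

variable [NeZero k]

/-- Only the mixture is assumed non-concentrated; this is the price, a factor `k`, for statements
about the draw of one particular player. -/
theorem le_mul_mixture (i : Fin k) (A : Set (SpherePt d)) : D i A ≤ k * mixture D A := by
  rw [mixture_apply, ← mul_assoc, ENNReal.mul_inv_cancel (by simpa using NeZero.ne k)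
    (ENNReal.natCast_ne_top k), one_mul]
  exact Finset.single_le_sum (f := fun i => D i A) (fun _ _ => zero_le) (Finset.mem_univ i)

/-- The law of the `n`-th draw when the draws of all players are read one after the other. -/
def drawMeasure (m n : ℕ) : Measure (SpherePt d × unitInterval) :=
  (D (Fin.ofNat k (n / m))).prod volume

theorem drawMeasure_prod (m n : ℕ) (A : Set (SpherePt d)) (B : Set unitInterval) :
    drawMeasure D m n (A ×ˢ B) = D (Fin.ofNat k (n / m)) A * volume B :=
  Measure.prod_prod A B

variable [∀ i, IsProbabilityMeasure (D i)]

instance isProbabilityMeasure_mixture : IsProbabilityMeasure (mixture D) where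
  measure_univ := by
    rw [mixture_apply]
    simp only [measure_univ, Finset.sum_const, Finset.card_univ, Fintype.card_fin, nsmul_eq_mul,
      mul_one]
    exact ENNReal.inv_mul_cancel (by simpa using NeZero.ne k) (ENNReal.natCast_ne_top k)

theorem mixture_real (A : Set (SpherePt d)) :
    (k : ℝ) * (mixture D).real A = ∑ i, (D i).real A := by
  have hk : (k : ℝ) ≠ 0 := by simpa using NeZero.ne k
  rw [Measure.real, mixture_apply, ENNReal.toReal_mul, ENNReal.toReal_inv,
    ENNReal.toReal_natCast, ENNReal.toReal_sum fun i _ => measure_ne_top _ _, ← mul_assoc,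
    mul_inv_cancel₀ hk, one_mul]
  rfl

instance isProbabilityMeasure_drawMeasure (m n : ℕ) : IsProbabilityMeasure (drawMeasure D m n) := by
  unfold drawMeasure; infer_instance

theorem drawLaw_map_flatten (m : ℕ) [NeZero m] :
    (drawLaw m D).map (flatten m) = Measure.infinitePi (drawMeasure D m) :=
  map_flatten m fun t => (D (Fin.ofNat k t)).prod volume

/-- The reason why different players do no harm: an expected count over a pass depends on the
mixture only. -/
theorem sum_drawMeasure_pass (m : ℕ) [NeZero m] (p : ℕ) (A : Set (SpherePt d))
    (B : Set unitInterval) :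
    ∑ j ∈ Finset.range (k * m), (drawMeasure D m (p * (k * m) + j)).real (A ×ˢ B) =
      k * m * ((mixture D).real A * volume.real B) := by
  simp only [Measure.real, drawMeasure_prod, ENNReal.toReal_mul]
  rw [← Finset.sum_mul, sum_range_pass m p fun i => (D i A).toReal]
  have := mixture_real D A
  simp only [Measure.real] at this
  rw [← this]
  ring

end Mixture

/-! ### Failure probabilities of a single test or update pass -/

/-- The points that the hypothesis `w` misclassifies. -/
def misclassified {d : ℕ} (ws w : EuclideanSpace ℝ (Fin d)) : Set (SpherePt d) :=
  {x | sepLabel ws x * inner ℝ w (x : EuclideanSpace ℝ (Fin d)) ≤ 0}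

/-- The pairs of a hypothesis and a draw that it misclassifies. -/
def errorPairs {d : ℕ} (ws : EuclideanSpace ℝ (Fin d)) :
    Set (EuclideanSpace ℝ (Fin d) × (SpherePt d × unitInterval)) :=
  {p | (labeled ws p.2).margin p.1 ≤ 0}

/-- The pairs of a displacement `v` of norm at most `s - 1` and a selected draw whose margin is
changed by at least `1` by the displacement. -/
def disturbedPairs (d : ℕ) (β : unitInterval) (s : ℕ) :
    Set (EuclideanSpace ℝ (Fin d) × (SpherePt d × unitInterval)) :=
  {p | (‖p.1‖ + 1 ≤ s ∧ p.2.2 < β) ∧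
    1 ≤ |inner ℝ p.1 (p.2.1 : EuclideanSpace ℝ (Fin d))|}

section Events

variable {d : ℕ} (ws : EuclideanSpace ℝ (Fin d)) (β : unitInterval)

theorem measurableSet_errorPairs : MeasurableSet (errorPairs ws) :=
  measurableSet_le (measurable_margin ws) measurable_const

theorem measurableSet_selected : MeasurableSet
    {p : EuclideanSpace ℝ (Fin d) × (SpherePt d × unitInterval) | p.2.2 < β} :=
  measurableSet_lt (by fun_prop) measurable_const

theorem measurableSet_disturbedPairs (s : ℕ) : MeasurableSet (disturbedPairs d β s) := by
  refine MeasurableSet.inter (MeasurableSet.inter ?_ (measurableSet_selected β)) ?_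
  · exact measurableSet_le
      (f := fun p : EuclideanSpace ℝ (Fin d) × (SpherePt d × unitInterval) => ‖p.1‖ + 1)
      (by fun_prop) measurable_const
  · exact measurableSet_le (g := fun p : EuclideanSpace ℝ (Fin d) × (SpherePt d × unitInterval) =>
      |inner ℝ p.1 (p.2.1 : EuclideanSpace ℝ (Fin d))|) measurable_const (by fun_prop)

theorem slice_errorPairs (w : EuclideanSpace ℝ (Fin d)) :
    {z | (w, z) ∈ errorPairs ws} = misclassified ws w ×ˢ Set.univ := by
  ext z; simp [errorPairs, misclassified, labeled, Draw.margin]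

theorem slice_selected_errorPairs (w : EuclideanSpace ℝ (Fin d)) :
    {z | (w, z) ∈ errorPairs ws ∩ {p | p.2.2 < β}} = misclassified ws w ×ˢ Set.Iio β := by
  ext z; simp [errorPairs, misclassified, labeled, Draw.margin]

theorem measurable_error (μ : Measure (SpherePt d)) [IsProbabilityMeasure μ] :
    Measurable fun w => μ.real (misclassified ws w) := by
  have hS : MeasurableSet {p : EuclideanSpace ℝ (Fin d) × SpherePt d |
      sepLabel ws p.2 * inner ℝ p.1 (p.2 : EuclideanSpace ℝ (Fin d)) ≤ 0} :=
    measurableSet_le (((measurable_sepLabel ws).comp measurable_snd).mul (by fun_prop))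
      measurable_const
  exact (measurable_measure_prodMk_left (ν := μ) hS).ennreal_toReal

variable {k : ℕ} [NeZero k] (D : Fin k → Measure (SpherePt d)) [∀ i, IsProbabilityMeasure (D i)]
  (m : ℕ)

/-- A selected draw is unlikely to be disturbed by a short displacement of the hypothesis. -/
theorem measure_disturbed_le [NeZero d] {c : ℝ} (hc : 0 ≤ c) (hD : NonConcentrated c (mixture D))
    {s : ℕ} {η : ℝ} (hη0 : 0 ≤ η) (hη : 2 ≤ s → Real.exp (-(d / (2 * s ^ 2))) ≤ η) (n n' : ℕ)
    (hn : n ≤ n') :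
    Measure.infinitePi (drawMeasure D m) {y |
      (hypAfter (k * m) β ws y n' - hypAfter (k * m) β ws y n, y n') ∈ disturbedPairs d β s} ≤
      ENNReal.ofReal (β * (k * (c * (2 * η)))) := by
  -- The displacement depends on draws before `n'` only, so the draw `n'` is independent of it.
  refine measure_infinitePi_resample_le (drawMeasure D m) n'
    (f := fun y => hypAfter (k * m) β ws y n' - hypAfter (k * m) β ws y n)
    ((measurable_hypAfter _ _ _ n').sub (measurable_hypAfter _ _ _ n)) (fun y z => by
      rw [hypAfter_update _ _ _ _ le_rfl, hypAfter_update _ _ _ _ hn])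
    (measurableSet_disturbedPairs β s) fun v => ?_
  by_cases hv : ‖v‖ + 1 ≤ s
  · have hset : {z | (v, z) ∈ disturbedPairs d β s} =
        {x : SpherePt d | 1 ≤ |inner ℝ v (x : EuclideanSpace ℝ (Fin d))|} ×ˢ Set.Iio β := by
      ext z; simp [disturbedPairs, hv, and_comm]
    have hm : MeasurableSet {x : SpherePt d | 1 ≤ |inner ℝ v (x : EuclideanSpace ℝ (Fin d))|} :=
      measurableSet_le measurable_const (by fun_prop)
    rw [hset, drawMeasure_prod, unitInterval.volume_Iio, mul_comm, ENNReal.ofReal_mul β.2.1,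
      ENNReal.ofReal_mul (Nat.cast_nonneg k), ENNReal.ofReal_mul hc, ENNReal.ofReal_natCast]
    gcongr
    refine (le_mul_mixture D _ _).trans ?_
    gcongr
    refine (hD.apply_le hm).trans ?_
    gcongr
    exact sphereUniform_abs_inner_ge_le d hv hη0 hη
  · have hset : {z | (v, z) ∈ disturbedPairs d β s} = ∅ := by
      ext z; simp [disturbedPairs, hv]
    simp [hset]

variable [NeZero m]

theorem sum_error_pass (p : ℕ) (w : EuclideanSpace ℝ (Fin d)) :
    ∑ j ∈ Finset.range (k * m),
      (drawMeasure D m (p * (k * m) + j)).real {z | (w, z) ∈ errorPairs ws} =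
      k * m * (mixture D).real (misclassified ws w) := by
  rw [slice_errorPairs, sum_drawMeasure_pass]; simp

theorem sum_selected_error_pass (p : ℕ) (w : EuclideanSpace ℝ (Fin d)) :
    ∑ j ∈ Finset.range (k * m),
      (drawMeasure D m (p * (k * m) + j)).real {z | (w, z) ∈ errorPairs ws ∩ {p | p.2.2 < β}} =
      k * m * ((mixture D).real (misclassified ws w) * β) := by
  rw [slice_selected_errorPairs, sum_drawMeasure_pass]; simp [Measure.real, β.2.1]

/-- A hypothesis of error more than `ε` is unlikely to pass a test. -/
theorem measure_test_passed_le {ε : ℝ} (hε : 0 ≤ ε) (q : ℕ) :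
    Measure.infinitePi (drawMeasure D m) {y |
      ε < (mixture D).real (misclassified ws (hypAfter (k * m) β ws y (2 * q * (k * m)))) ∧
      (testCount (k * m) β ws y q : ℝ) ≤ ε / 2 * (k * m)} ≤
      ENNReal.ofReal (Real.exp (-(ε * (k * m) / 40))) := by
  have h := measure_block_count_le_half (drawMeasure D m) (2 * q * (k * m))
    (measurable_hypAfter (k * m) β ws (2 * q * (k * m)))
    (fun n y z hn => hypAfter_update _ _ _ _ hn z) (measurableSet_errorPairs ws)
    (G := {w | ε < (mixture D).real (misclassified ws w)})
    (measurableSet_lt measurable_const (measurable_error ws _)) (k * m) (M := ε * (k * m))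
    (by positivity) (fun w hw => by
      rw [sum_error_pass]
      have : ε < (mixture D).real (misclassified ws w) := hw
      have h0 : (0 : ℝ) ≤ k * m := by positivity
      nlinarith)
  refine le_trans (measure_mono ?_) (h.trans (ENNReal.ofReal_le_ofReal ?_))
  · rintro y ⟨h1, h2⟩
    refine ⟨h1, ?_⟩
    have h3 : ε * (k * m) / 2 = ε / 2 * (k * m) := by ring
    rw [h3]
    refine le_trans (le_of_eq ?_) h2
    congr 1
  · rw [Real.exp_le_exp]
    have : 0 ≤ ε * (k * m) := by positivity
    linarith

/-- A hypothesis of error less than `ε / 4` is unlikely to fail a test. -/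
theorem measure_test_failed_le {ε : ℝ} (hε : 0 ≤ ε) (q : ℕ) :
    Measure.infinitePi (drawMeasure D m) {y |
      (mixture D).real (misclassified ws (hypAfter (k * m) β ws y (2 * q * (k * m)))) < ε / 4 ∧
      ε / 2 * (k * m) < (testCount (k * m) β ws y q : ℝ)} ≤
      ENNReal.ofReal (Real.exp (-(ε * (k * m) / 40))) := by
  have h := measure_block_count_ge_two_mul (drawMeasure D m) (2 * q * (k * m))
    (measurable_hypAfter (k * m) β ws (2 * q * (k * m)))
    (fun n y z hn => hypAfter_update _ _ _ _ hn z) (measurableSet_errorPairs ws)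
    (G := {w | (mixture D).real (misclassified ws w) < ε / 4})
    (measurableSet_lt (measurable_error ws _) measurable_const) (k * m) (M := ε / 4 * (k * m))
    (by positivity) (fun w hw => by
      rw [sum_error_pass]
      have : (mixture D).real (misclassified ws w) < ε / 4 := hw
      have h0 : (0 : ℝ) ≤ k * m := by positivity
      nlinarith)
  refine le_trans (measure_mono ?_) (h.trans (ENNReal.ofReal_le_ofReal ?_))
  · rintro y ⟨h1, h2⟩
    refine ⟨h1, ?_⟩
    have h3 : 2 * (ε / 4 * (k * m)) = ε / 2 * (k * m) := by ring
    rw [h3]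
    refine le_trans h2.le (le_of_eq ?_)
    congr 1
  · rw [Real.exp_le_exp]
    apply le_of_eq
    ring

/-- If the hypothesis at the start of an update pass has error at least `ε / 4`, it is unlikely
that there are fewer than `s` updates in the pass. -/
theorem measure_few_updates_le [NeZero d] {c : ℝ} (hc : 0 ≤ c) (hD : NonConcentrated c (mixture D))
    {s : ℕ} {η : ℝ} (hη0 : 0 ≤ η) (hη : 2 ≤ s → Real.exp (-(d / (2 * s ^ 2))) ≤ η)
    {ε : ℝ} (hε : 0 ≤ ε) (hs : (s : ℝ) ≤ (β : ℝ) * (k * m) * ε / 8) (q : ℕ) :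
    Measure.infinitePi (drawMeasure D m) {y |
      ε / 4 ≤ (mixture D).real
        (misclassified ws (hypAfter (k * m) β ws y ((2 * q + 1) * (k * m)))) ∧
      ∑ j ∈ Finset.range (k * m), updated (k * m) β ws y ((2 * q + 1) * (k * m) + j) < s} ≤
      ENNReal.ofReal (Real.exp (-((β : ℝ) * (k * m) * ε / 40)) +
        (k * m : ℕ) * ((β : ℝ) * (k * (c * (2 * η))))) := by
  classical
  set N := k * m with hN
  have hNpos : 0 < N := Nat.mul_pos (Nat.pos_of_ne_zero (NeZero.ne k))
    (Nat.pos_of_ne_zero (NeZero.ne m))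
  have hβ0 : (0 : ℝ) ≤ β := β.2.1
  set n₀ := (2 * q + 1) * N with hn₀
  have hcast : ((N : ℕ) : ℝ) = k * m := by rw [hN]; push_cast; ring
  obtain ⟨S, hS⟩ : ∃ S, S = errorPairs ws ∩ {p | p.2.2 < β} := ⟨_, rfl⟩
  have h1 := measure_block_count_le_half (drawMeasure D m) n₀
    (measurable_hypAfter N β ws n₀)
    (fun n y z hn => hypAfter_update _ _ _ _ hn z)
    (hS ▸ (measurableSet_errorPairs ws).inter (measurableSet_selected β) : MeasurableSet S)
    (G := {w | ε / 4 ≤ (mixture D).real (misclassified ws w)})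
    (measurableSet_le measurable_const (measurable_error ws _)) N (M := (β : ℝ) * (k * m) * ε / 4)
    (by positivity) (fun w hw => by
      rw [hS, hn₀, hN, sum_selected_error_pass]
      have : ε / 4 ≤ (mixture D).real (misclassified ws w) := hw
      have h0 : (0 : ℝ) ≤ β * (k * m) := by positivity
      nlinarith)
  rw [ENNReal.ofReal_add (by positivity) (by positivity), ENNReal.ofReal_mul (Nat.cast_nonneg N),
    ENNReal.ofReal_natCast]
  -- Without a disturbed draw, every selected example misclassified at the start of the pass becomes
  -- an update. Fewer than `s` updates then forces the count of such examples below `s`, which is at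
  -- most half of the lower bound on its mean.
  have hsub : {y : ℕ → SpherePt d × unitInterval |
      ε / 4 ≤ (mixture D).real (misclassified ws (hypAfter N β ws y n₀)) ∧
      ∑ j ∈ Finset.range N, updated N β ws y (n₀ + j) < s} ⊆
      {y | hypAfter N β ws y n₀ ∈ {w | ε / 4 ≤ (mixture D).real (misclassified ws w)} ∧
        ((∑ j ∈ Finset.range N, if (hypAfter N β ws y n₀, y (n₀ + j)) ∈ S then 1 else 0 : ℕ) : ℝ) ≤ (β : ℝ) * (k * m) * ε / 4 / 2} ∪
      ⋃ j ∈ Finset.range N, {y | (hypAfter N β ws y (n₀ + j) - hypAfter N β ws y n₀, y (n₀ + j)) ∈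
        disturbedPairs d β s} := by
    rintro y ⟨hy1, hy2⟩
    by_cases hy3 : y ∈ ⋃ j ∈ Finset.range N,
        {y | (hypAfter N β ws y (n₀ + j) - hypAfter N β ws y n₀, y (n₀ + j)) ∈
        disturbedPairs d β s}
    · exact Or.inr hy3
    refine Or.inl ⟨hy1, ?_⟩
    have hle : (∑ j ∈ Finset.range N, if (hypAfter N β ws y n₀, y (n₀ + j)) ∈ S then 1 else 0) ≤
        ∑ j ∈ Finset.range N, updated N β ws y (n₀ + j) := by
      refine Finset.sum_le_sum fun j hj => ?_
      split_ifs with hA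
      · obtain ⟨hA1, hA2⟩ : (_ : _ × _) ∈ errorPairs ws ∩ {p | p.2.2 < β} := hS ▸ hA
        have hjN := Finset.mem_range.1 hj
        have hdiv : (n₀ + j) / N % 2 ≠ 0 := by
          rw [hn₀, mul_comm _ N, Nat.mul_add_div hNpos, Nat.div_eq_of_lt hjN]; omega
        -- Strictly fewer than `s` unit steps have been made, hence the bound `s - 1` and not `s`.
        have hnorm : ‖hypAfter N β ws y (n₀ + j) - hypAfter N β ws y n₀‖ + 1 ≤ s := by
          have hu := norm_hypAfter_sub_le N β ws y n₀ j
          have hmono : ∑ i ∈ Finset.range j, updated N β ws y (n₀ + i) ≤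
              ∑ i ∈ Finset.range N, updated N β ws y (n₀ + i) :=
            Finset.sum_le_sum_of_subset (Finset.range_subset_range.2 hjN.le)
          have : ((∑ i ∈ Finset.range j, updated N β ws y (n₀ + i) : ℕ) : ℝ) + 1 ≤ s := by
            exact_mod_cast Nat.succ_le_of_lt (hmono.trans_lt hy2)
          push_cast at this
          linarith
        have hnd : ¬ (1 ≤ |inner ℝ (hypAfter N β ws y (n₀ + j) - hypAfter N β ws y n₀)
            ((y (n₀ + j)).1 : EuclideanSpace ℝ (Fin d))|) := fun hge =>
          hy3 (Set.mem_biUnion hj ⟨⟨hnorm, hA2⟩, hge⟩)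
        refine le_of_eq (if_pos ⟨hdiv, hA2, ?_⟩).symm
        have hm0 : sepLabel ws (y (n₀ + j)).1 * inner ℝ (hypAfter N β ws y n₀)
            ((y (n₀ + j)).1 : EuclideanSpace ℝ (Fin d)) ≤ 0 := hA1
        change sepLabel ws (y (n₀ + j)).1 * inner ℝ (hypAfter N β ws y (n₀ + j))
            ((y (n₀ + j)).1 : EuclideanSpace ℝ (Fin d)) < 1
        have hsplit : hypAfter N β ws y (n₀ + j) = hypAfter N β ws y n₀ +
            (hypAfter N β ws y (n₀ + j) - hypAfter N β ws y n₀) := by abel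
        have habs : sepLabel ws (y (n₀ + j)).1 *
            inner ℝ (hypAfter N β ws y (n₀ + j) - hypAfter N β ws y n₀)
            ((y (n₀ + j)).1 : EuclideanSpace ℝ (Fin d)) < 1 := by
          refine lt_of_le_of_lt (le_abs_self _) ?_
          rw [abs_mul, abs_sepLabel, one_mul]
          exact not_le.1 hnd
        rw [hsplit, inner_add_left, mul_add]
        linarith
      · exact Nat.zero_le _
    have h2 : ((∑ j ∈ Finset.range N, if (hypAfter N β ws y n₀, y (n₀ + j)) ∈ S then 1 else 0 : ℕ) : ℝ) ≤ s := by
      exact_mod_cast hle.trans hy2.le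
    linarith
  refine (measure_mono hsub).trans ((measure_union_le _ _).trans (add_le_add ?_ ?_))
  · refine h1.trans (ENNReal.ofReal_le_ofReal (Real.exp_le_exp.2 (le_of_eq ?_)))
    ring
  · refine (measure_biUnion_finset_le _ _).trans ?_
    calc _ ≤ ∑ _j ∈ Finset.range N, ENNReal.ofReal (β * (k * (c * (2 * η)))) :=
          Finset.sum_le_sum fun j _ =>
            measure_disturbed_le ws β D m hc hD hη0 hη n₀ (n₀ + j) (Nat.le_add_right _ _)
      _ = _ := by simp

end Events

/-! ### Counting over the whole run -/

theorem sum_range_updatePasses {f : ℕ → ℕ} {N : ℕ} (hf : ∀ n, n / N % 2 = 0 → f n = 0) (Q : ℕ) :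
    ∑ n ∈ Finset.range (2 * Q * N), f n =
      ∑ q ∈ Finset.range Q, ∑ j ∈ Finset.range N, f ((2 * q + 1) * N + j) := by
  induction Q with
  | zero => simp
  | succ Q ih =>
    rw [Finset.sum_range_succ, show 2 * (Q + 1) * N = 2 * Q * N + N + N by ring,
      Finset.sum_range_add, Finset.sum_range_add, ih]
    have : ∑ j ∈ Finset.range N, f (2 * Q * N + j) = 0 := by
      refine Finset.sum_eq_zero fun j hj => hf _ ?_
      have hjN := Finset.mem_range.1 hj
      rw [mul_comm (2 * Q) N, Nat.mul_add_div (by omega), Nat.div_eq_of_lt hjN]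
      omega
    rw [this, show 2 * Q * N + N = (2 * Q + 1) * N by ring]
    ring

section Core

variable {d : ℕ} (ws : EuclideanSpace ℝ (Fin d)) (β : unitInterval)

theorem measurable_updated (N n : ℕ) :
    Measurable fun y : ℕ → SpherePt d × unitInterval => updated N β ws y n := by
  unfold updated
  refine Measurable.ite ((MeasurableSet.const _).inter ((measurableSet_lt
    (f := fun y : ℕ → SpherePt d × unitInterval => (y n).2) (by fun_prop) measurable_const).inter
    (measurableSet_lt ((measurable_margin ws).comp
      ((measurable_hypAfter N β ws n).prodMk (measurable_pi_apply n))) measurable_const)))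
    measurable_const measurable_const

/-- The perceptron bound: the number `M` of updates and the number `L` of examples of small margin
cannot satisfy `24 < γ² M₀`, `M₀ / 2 ≤ M` and `L < M₀ / 4`. -/
theorem updates_bound {N : ℕ} (hws : ‖ws‖ = 1) {γ : ℝ} (hγ : 0 < γ)
    (y : ℕ → SpherePt d × unitInterval) (n : ℕ) {M₀ : ℝ} (h0 : 0 < M₀)
    (hM : M₀ / 2 ≤ ((∑ j ∈ Finset.range n, updated N β ws y j : ℕ) : ℝ))
    (hL : ((∑ j ∈ Finset.range n, smallMargin N β ws γ y j : ℕ) : ℝ) < M₀ / 4) :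
    γ ^ 2 * M₀ ≤ 24 := by
  push_cast at hM hL
  have h1 := norm_sq_hypAfter_le N β ws y n
  have h2 := le_inner_hypAfter N β ws y hγ.le n
  set M := ∑ j ∈ Finset.range n, (updated N β ws y j : ℝ)
  set L := ∑ j ∈ Finset.range n, (smallMargin N β ws γ y j : ℝ)
  have h3 : inner ℝ ws (hypAfter N β ws y n) ≤ ‖hypAfter N β ws y n‖ := by
    have := real_inner_le_norm ws (hypAfter N β ws y n)
    rwa [hws, one_mul] at this
  have hMpos : 0 < M := by linarith
  -- `L < M₀ / 4 ≤ M / 2`, so at least half of the updates count as progress `γ`.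
  have h4 : γ * (M / 2) ≤ ‖hypAfter N β ws y n‖ := by
    refine le_trans ?_ (h2.trans h3)
    gcongr
    linarith
  have h5 : (γ * (M / 2)) ^ 2 ≤ 3 * M := (pow_le_pow_left₀ (by positivity) h4 2).trans h1
  have h6 : γ ^ 2 * M ≤ 12 := by
    have : γ ^ 2 * M * M ≤ 12 * M := by nlinarith
    exact le_of_mul_le_mul_right this hMpos
  nlinarith [sq_nonneg γ]

variable {k : ℕ} [NeZero k] (D : Fin k → Measure (SpherePt d)) [∀ i, IsProbabilityMeasure (D i)]
  (m : ℕ) [NeZero m]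

/-- Selection and distance to the target's boundary do not involve the hypothesis, so the marginal
laws of the draws and the slab estimate suffice. -/
theorem sum_smallMargin_pass_le [NeZero d] {c : ℝ} (hc : 0 ≤ c)
    (hD : NonConcentrated c (mixture D)) (hws : ‖ws‖ = 1) {γ : ℝ} (hγ : 0 < γ) (p : ℕ) :
    ∑ j ∈ Finset.range (k * m), Measure.infinitePi (drawMeasure D m)
      {y | (y (p * (k * m) + j)).2 < β ∧
        |inner ℝ ws ((y (p * (k * m) + j)).1 : EuclideanSpace ℝ (Fin d))| ≤ γ} ≤
      ENNReal.ofReal (β * (k * m) * (c * (12 * γ * √d))) := by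
  set A : Set (SpherePt d) := {x | |inner ℝ ws (x : EuclideanSpace ℝ (Fin d))| ≤ γ} with hA
  have hAm : MeasurableSet A := measurableSet_le (by fun_prop) measurable_const
  have hone : ∀ n, Measure.infinitePi (drawMeasure D m)
      {y | (y n).2 < β ∧ |inner ℝ ws ((y n).1 : EuclideanSpace ℝ (Fin d))| ≤ γ} =
      ENNReal.ofReal ((drawMeasure D m n).real (A ×ˢ Set.Iio β)) := by
    intro n
    have h := (measurePreserving_eval_infinitePi (drawMeasure D m) n).measure_preimage
      (hAm.prod measurableSet_Iio).nullMeasurableSet (s := A ×ˢ Set.Iio β)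
    rw [Measure.real, ENNReal.ofReal_toReal (measure_ne_top _ _), ← h]
    congr 1
    ext y
    simp [hA, and_comm]
  have hAle : (mixture D).real A ≤ c * (12 * γ * √d) := by
    refine ENNReal.toReal_le_of_le_ofReal (by positivity) ((hD.apply_le hAm).trans ?_)
    rw [ENNReal.ofReal_mul hc]
    gcongr
    exact sphereUniform_slab_le d hws hγ
  simp only [hone]
  rw [← ENNReal.ofReal_sum_of_nonneg fun _ _ => measureReal_nonneg, sum_drawMeasure_pass]
  refine ENNReal.ofReal_le_ofReal ?_
  have hβ : (volume : Measure unitInterval).real (Set.Iio β) = β := by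
    simp [Measure.real, β.2.1]
  rw [hβ]
  have hβ0 : (0 : ℝ) ≤ β := β.2.1
  calc (k : ℝ) * m * ((mixture D).real A * β) = β * (k * m) * (mixture D).real A := by ring
    _ ≤ _ := by gcongr

/-- The draws for which the `q`-th test gives a wrong result: a hypothesis of error more than `ε`
passes, or one of error less than `ε / 4` fails. -/
def wrongTest (ε : ℝ) (q : ℕ) : Set (ℕ → SpherePt d × unitInterval) :=
  {y | ε < (mixture D).real (misclassified ws (hypAfter (k * m) β ws y (2 * q * (k * m)))) ∧
      (testCount (k * m) β ws y q : ℝ) ≤ ε / 2 * (k * m)} ∪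
  {y | (mixture D).real (misclassified ws (hypAfter (k * m) β ws y (2 * q * (k * m)))) < ε / 4 ∧
      ε / 2 * (k * m) < (testCount (k * m) β ws y q : ℝ)}

/-- The draws for which the `q`-th update pass starts from a hypothesis of error at least `ε / 4`
and has fewer than `s` updates. -/
def slowPass (ε : ℝ) (s q : ℕ) : Set (ℕ → SpherePt d × unitInterval) :=
  {y | ε / 4 ≤ (mixture D).real
        (misclassified ws (hypAfter (k * m) β ws y ((2 * q + 1) * (k * m)))) ∧
      ∑ j ∈ Finset.range (k * m), updated (k * m) β ws y ((2 * q + 1) * (k * m) + j) < s}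

theorem measure_wrongTest_le {ε : ℝ} (hε : 0 ≤ ε) (Q : ℕ) :
    Measure.infinitePi (drawMeasure D m) (⋃ q ∈ Finset.range Q, wrongTest ws β D m ε q) ≤
      ENNReal.ofReal (Q * (2 * Real.exp (-(ε * (k * m) / 40)))) := by
  refine (measure_biUnion_finset_le _ _).trans ?_
  calc _ ≤ ∑ _q ∈ Finset.range Q, ENNReal.ofReal (2 * Real.exp (-(ε * (k * m) / 40))) := by
        refine Finset.sum_le_sum fun q _ => (measure_union_le _ _).trans ?_
        rw [two_mul (Real.exp _), ENNReal.ofReal_add (Real.exp_pos _).le (Real.exp_pos _).le]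
        exact add_le_add (measure_test_passed_le ws β D m hε q)
          (measure_test_failed_le ws β D m hε q)
    _ = _ := by
        rw [Finset.sum_const, Finset.card_range, nsmul_eq_mul,
          ENNReal.ofReal_mul (Nat.cast_nonneg Q), ENNReal.ofReal_natCast]

/-- Markov's inequality over all update passes; a fixed failure probability is enough, so no
concentration is needed. -/
theorem measure_smallMargin_ge_le [NeZero d] {c : ℝ} (hc : 0 ≤ c)
    (hD : NonConcentrated c (mixture D)) (hws : ‖ws‖ = 1) {γ : ℝ} (hγ : 0 < γ) (Q : ℕ)
    {a : ℝ} (ha : 0 < a) :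
    Measure.infinitePi (drawMeasure D m)
      {y | a ≤ ((∑ n ∈ Finset.range (2 * Q * (k * m)), smallMargin (k * m) β ws γ y n : ℕ) : ℝ)} ≤
      ENNReal.ofReal (Q * ((β : ℝ) * (k * m) * (c * (12 * γ * √d))) / a) := by
  classical
  let E : ℕ × ℕ → Set (ℕ → SpherePt d × unitInterval) := fun i =>
    {y | (y ((2 * i.1 + 1) * (k * m) + i.2)).2 < β ∧
      |inner ℝ ws ((y ((2 * i.1 + 1) * (k * m) + i.2)).1 : EuclideanSpace ℝ (Fin d))| ≤ γ}
  have hEm : ∀ i, MeasurableSet (E i) := fun i =>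
    (measurableSet_lt (f := fun y : ℕ → SpherePt d × unitInterval =>
      (y ((2 * i.1 + 1) * (k * m) + i.2)).2) (by fun_prop) measurable_const).inter
    (measurableSet_le (f := fun y : ℕ → SpherePt d × unitInterval =>
      |inner ℝ ws ((y ((2 * i.1 + 1) * (k * m) + i.2)).1 : EuclideanSpace ℝ (Fin d))|)
      (by fun_prop) measurable_const)
  have hsum : ∑ i ∈ Finset.range Q ×ˢ Finset.range (k * m),
      Measure.infinitePi (drawMeasure D m) (E i) ≤
      ENNReal.ofReal (Q * ((β : ℝ) * (k * m) * (c * (12 * γ * √d)))) := by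
    rw [Finset.sum_product, ENNReal.ofReal_mul (Nat.cast_nonneg Q), ENNReal.ofReal_natCast]
    have h := Finset.sum_le_sum fun q (_ : q ∈ Finset.range Q) =>
      sum_smallMargin_pass_le ws β D m hc hD hws hγ (2 * q + 1)
    rwa [Finset.sum_const, Finset.card_range, nsmul_eq_mul] at h
  refine le_trans (measure_mono ?_)
    (measure_count_events_ge_le (Measure.infinitePi (drawMeasure D m)) _ (fun i _ => hEm i) ha hsum)
  intro y hy
  refine le_of_le_of_eq (b := ((∑ n ∈ Finset.range (2 * Q * (k * m)),
    smallMargin (k * m) β ws γ y n : ℕ) : ℝ)) hy ?_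
  congr 1
  rw [sum_range_updatePasses (f := smallMargin (k * m) β ws γ y)
    (fun n hn => if_neg fun h => h.1 hn), Finset.sum_product]
  refine Finset.sum_congr rfl fun q _ => Finset.sum_congr rfl fun j hj => ?_
  have hjN := Finset.mem_range.1 hj
  have hdiv : ((2 * q + 1) * (k * m) + j) / (k * m) % 2 ≠ 0 := by
    rw [mul_comm _ (k * m), Nat.mul_add_div (by omega), Nat.div_eq_of_lt hjN]; omega
  simp [smallMargin, E, hdiv]

-- Slow passes are dependent through the hypothesis, but a bound for each one and linearity of
-- expectation suffice, as only a constant fraction of the passes has to be fast.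
open Classical in
theorem measure_slowPass_ge_le [NeZero d] {c : ℝ} (hc : 0 ≤ c)
    (hD : NonConcentrated c (mixture D))
    {s : ℕ} {η : ℝ} (hη0 : 0 ≤ η) (hη : 2 ≤ s → Real.exp (-(d / (2 * s ^ 2))) ≤ η)
    {ε : ℝ} (hε : 0 ≤ ε) (hs : (s : ℝ) ≤ (β : ℝ) * (k * m) * ε / 8) (Q : ℕ)
    {a : ℝ} (ha : 0 < a) :
    Measure.infinitePi (drawMeasure D m)
      {y | a ≤ ((∑ q ∈ Finset.range Q, if y ∈ slowPass ws β D m ε s q then 1 else 0 : ℕ) : ℝ)} ≤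
      ENNReal.ofReal (Q * (Real.exp (-((β : ℝ) * (k * m) * ε / 40)) +
          (k * m : ℕ) * ((β : ℝ) * (k * (c * (2 * η))))) / a) := by
  have hZm : ∀ q, MeasurableSet (slowPass ws β D m ε s q) := fun q =>
    (measurableSet_le measurable_const
      ((measurable_error ws (mixture D)).comp (measurable_hypAfter (k * m) β ws _))).inter
    (measurableSet_lt (Finset.measurable_sum _ fun j _ => measurable_updated ws β (k * m) _)
      measurable_const)
  refine measure_count_events_ge_le _ _ (fun q _ => hZm q) ha ?_
  rw [ENNReal.ofReal_mul (Nat.cast_nonneg Q), ENNReal.ofReal_natCast]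
  have h := Finset.sum_le_sum fun q (_ : q ∈ Finset.range Q) =>
    measure_few_updates_le ws β D m hc hD hη0 hη hε hs q
  rwa [Finset.sum_const, Finset.card_range, nsmul_eq_mul] at h

open Classical in
/-- The run learns if no test is wrong, few examples have small margin and few passes are slow. -/
theorem learnsWithin_of_counts (hws : ‖ws‖ = 1) {γ : ℝ} (hγ : 0 < γ) {ε : ℝ} {s Q : ℕ}
    (hQ : 24 < γ ^ 2 * (s * Q)) (ω : ℕ → Fin m → SpherePt d × unitInterval)
    (h1 : ∀ q < Q, flatten m ω ∉ wrongTest ws β D m ε q)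
    (h2 : ((∑ n ∈ Finset.range (2 * Q * (k * m)),
      smallMargin (k * m) β ws γ (flatten m ω) n : ℕ) : ℝ) < s * Q / 4)
    (h3 : ((∑ q ∈ Finset.range Q, if flatten m ω ∈ slowPass ws β D m ε s q then 1 else 0 : ℕ) : ℝ)
      < Q / 2) :
    LearnsWithin k m β ε (2 * k * Q) (mixture D) ws (labelDraws ws ω) := by
  have hQs : 0 < (s : ℝ) * Q := by
    by_contra h
    push Not at h
    nlinarith [sq_nonneg γ]
  set y := flatten m ω with hy
  refine learnsWithin_of_testCount β ws ω ?_ fun q hq hle => ?_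
  -- If all `Q` tests fail and none is wrong, every pass starts with error at least `ε / 4`. The
  -- passes that are not slow, more than half, then give at least `s Q / 2` updates, contradicting
  -- the Perceptron bound.
  · by_contra hno
    push Not at hno
    have herr : ∀ q < Q, ε / 4 ≤ (mixture D).real
        (misclassified ws (hypAfter (k * m) β ws y ((2 * q + 1) * (k * m)))) := by
      intro q hq
      have : hypAfter (k * m) β ws y ((2 * q + 1) * (k * m)) =
          hypAfter (k * m) β ws y (2 * q * (k * m)) := by
        rw [show (2 * q + 1) * (k * m) = 2 * q * (k * m) + k * m by ring]
        exact hypAfter_testPass (k * m) β ws y (k * m) le_rfl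
      rw [this]
      by_contra hlt
      exact h1 q hq (Or.inr ⟨not_le.1 hlt, hno q hq⟩)
    have hMsum : (s * Q : ℝ) / 2 ≤
        ((∑ n ∈ Finset.range (2 * Q * (k * m)), updated (k * m) β ws y n : ℕ) : ℝ) := by
      rw [sum_range_updatePasses (f := updated (k * m) β ws y)
        (fun n hn => if_neg fun h => h.1 hn)]
      have hq : ∀ q ∈ Finset.range Q,
          (s : ℝ) * (1 - (if y ∈ slowPass ws β D m ε s q then 1 else 0)) ≤
          ((∑ j ∈ Finset.range (k * m),
            updated (k * m) β ws y ((2 * q + 1) * (k * m) + j) : ℕ) : ℝ) := by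
        intro q hq
        split_ifs with hz
        · simp only [sub_self, mul_zero]; positivity
        · rw [sub_zero, mul_one, Nat.cast_le]
          by_contra hlt
          exact hz ⟨herr q (Finset.mem_range.1 hq), not_le.1 hlt⟩
      have hsum := Finset.sum_le_sum hq
      rw [← Finset.mul_sum, Finset.sum_sub_distrib] at hsum
      push_cast at h3 hsum ⊢
      simp only [Finset.sum_const, Finset.card_range, nsmul_eq_mul, mul_one] at hsum
      have hs0 : (0 : ℝ) ≤ s := Nat.cast_nonneg s
      refine le_trans ?_ hsum
      rw [mul_div_assoc]
      gcongr
      linarith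
    exact absurd (updates_bound ws β hws hγ y (2 * Q * (k * m)) hQs hMsum h2) (not_le.2 hQ)
  · by_contra hlt
    refine h1 q hq (Or.inl ⟨?_, hle⟩)
    by_contra hle'
    refine hlt ?_
    change mixture D (misclassified ws _) ≤ _
    rw [← ENNReal.ofReal_toReal (measure_ne_top (mixture D) _)]
    exact ENNReal.ofReal_le_ofReal (not_lt.1 hle')

/-- The failure probability of the round-robin margin Perceptron, as a function of its
parameters. -/
theorem drawLaw_not_learnsWithin_le [NeZero d] {c : ℝ} (hc : 0 ≤ c)
    (hD : NonConcentrated c (mixture D)) (hws : ‖ws‖ = 1) {γ : ℝ} (hγ : 0 < γ)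
    {s : ℕ} {η : ℝ} (hη0 : 0 ≤ η) (hη : 2 ≤ s → Real.exp (-(d / (2 * s ^ 2))) ≤ η)
    {ε : ℝ} (hε : 0 ≤ ε) (hs : (s : ℝ) ≤ (β : ℝ) * (k * m) * ε / 8) {Q : ℕ}
    (hQ : 24 < γ ^ 2 * (s * Q)) :
    drawLaw m D {ω | ¬ LearnsWithin k m β ε (2 * k * Q) (mixture D) ws (labelDraws ws ω)} ≤
      ENNReal.ofReal (Q * (2 * Real.exp (-(ε * (k * m) / 40))) +
        (Q * ((β : ℝ) * (k * m) * (c * (12 * γ * √d))) / (s * Q / 4) +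
        Q * (Real.exp (-((β : ℝ) * (k * m) * ε / 40)) +
          (k * m : ℕ) * ((β : ℝ) * (k * (c * (2 * η))))) / (Q / 2))) := by
  classical
  have hβ0 : (0 : ℝ) ≤ β := β.2.1
  have hQs : 0 < (s : ℝ) * Q := by
    by_contra h
    push Not at h
    nlinarith [sq_nonneg γ]
  have hQ0 : (0 : ℝ) < Q := by
    by_contra h
    have : (Q : ℝ) = 0 := le_antisymm (not_lt.1 h) (Nat.cast_nonneg Q)
    simp [this] at hQs
  have hP1 := measure_wrongTest_le ws β D m hε Q
  have hP2 := measure_smallMargin_ge_le ws β D m hc hD hws hγ Q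
    (by positivity : (0 : ℝ) < s * Q / 4)
  have hP3 := measure_slowPass_ge_le ws β D m hc hD hη0 hη hε hs Q (by positivity : (0 : ℝ) < Q / 2)
  rw [ENNReal.ofReal_add (by positivity) (by positivity),
    ENNReal.ofReal_add (by positivity) (by positivity)]
  refine le_trans ?_ (add_le_add hP1 (add_le_add hP2 hP3))
  refine le_trans ?_ ((measure_union_le _ _).trans (add_le_add le_rfl (measure_union_le _ _)))
  rw [← drawLaw_map_flatten]
  -- `Measure.le_map_apply` holds for arbitrary sets, so measurability of the learning event is
  -- never needed.
  refine le_trans (measure_mono fun ω hω => ?_)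
    (Measure.le_map_apply (measurable_flatten m).aemeasurable _)
  by_contra hn
  simp only [Set.mem_preimage, Set.mem_union, Set.mem_iUnion, Finset.mem_range, not_or,
    not_exists] at hn
  exact hω (learnsWithin_of_counts ws β D m hws hγ hQ ω hn.1 (not_le.1 hn.2.1) (not_le.1 hn.2.2))

end Core

/-! ### Normalization and choice of parameters -/

theorem NonConcentrated.mono {d : ℕ} {c c' : ℝ} {D : Measure (SpherePt d)}
    (h : NonConcentrated c D) (hc : c ≤ c') : NonConcentrated c' D := by
  obtain ⟨p, hp, hpc, rfl⟩ := h
  exact ⟨p, hp, fun x => (hpc x).trans (ENNReal.ofReal_le_ofReal hc), rfl⟩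

theorem sepLabel_smul {d : ℕ} {r : ℝ} (hr : 0 < r) (w : EuclideanSpace ℝ (Fin d)) :
    sepLabel (r • w) = sepLabel w := by
  ext x
  simp [sepLabel, inner_smul_left, hr]

theorem learnsWithin_smul {d k m : ℕ} (β : unitInterval) (ε : ℝ) (R : ℕ)
    (D : Measure (SpherePt d)) {r : ℝ} (hr : 0 < r) (w : EuclideanSpace ℝ (Fin d))
    (ω : ℕ → Fin m → SpherePt d × unitInterval) :
    LearnsWithin k m β ε R D (r • w) (labelDraws (r • w) ω) ↔
      LearnsWithin k m β ε R D w (labelDraws w ω) := by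
  have : labelDraws (r • w) ω = labelDraws w ω := by
    funext t j
    simp only [labelDraws, sepLabel_smul hr]
  simp only [LearnsWithin, sepError, this, sepLabel_smul hr]

/-- A crude bound suffices: sample sizes need only be polynomial, and `K` may depend on `δ` in any
way. -/
theorem exp_neg_le_inv {x : ℝ} (hx : 0 < x) : Real.exp (-x) ≤ 1 / x := by
  rw [Real.exp_neg, ← one_div]
  exact one_div_le_one_div_of_le hx (by linarith [Real.add_one_le_exp x])

/-- The number of updates to aim at in each pass: of order `√(d / L)`, but at least `1`. -/
theorem exists_update_target (d : ℕ) (hd : 1 ≤ d) {F : ℝ} (hF : 1 ≤ F) :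
    ∃ s : ℕ, 1 ≤ s ∧ s ≤ d ∧ (2 ≤ s → (s : ℝ) ^ 2 * F ≤ d) ∧ (d : ℝ) ≤ 2 * √(d * F) * s := by
  have hd' : (1 : ℝ) ≤ d := by exact_mod_cast hd
  set x := √(d / F) with hx
  have hx2 : x ^ 2 = d / F := Real.sq_sqrt (by positivity)
  have hx0 : 0 ≤ x := Real.sqrt_nonneg _
  have hfl : (⌊x⌋₊ : ℝ) ≤ x := Nat.floor_le hx0
  -- The floor may vanish; then `s = 1`, where no tail condition is imposed. The factor 2 in the
  -- last claim pays for rounding.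
  refine ⟨max 1 ⌊x⌋₊, le_max_left _ _, max_le hd ?_, fun h2 => ?_, ?_⟩
  · have h1 : x ≤ d := by
      rw [hx, Real.sqrt_le_left (by positivity)]
      calc (d : ℝ) / F ≤ d := div_le_self (by positivity) hF
        _ ≤ d ^ 2 := by nlinarith
    exact_mod_cast hfl.trans h1
  · have hmax : max 1 ⌊x⌋₊ = ⌊x⌋₊ := by omega
    rw [hmax]
    calc (⌊x⌋₊ : ℝ) ^ 2 * F ≤ x ^ 2 * F := by gcongr
      _ = (d : ℝ) := by rw [hx2]; field_simp
  · have h1 : x ≤ 2 * ((max 1 ⌊x⌋₊ : ℕ) : ℝ) := by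
      have ha : (1 : ℝ) ≤ ((max 1 ⌊x⌋₊ : ℕ) : ℝ) := by exact_mod_cast le_max_left _ _
      have hb : (⌊x⌋₊ : ℝ) ≤ ((max 1 ⌊x⌋₊ : ℕ) : ℝ) := by exact_mod_cast le_max_right _ _
      have hc := Nat.lt_floor_add_one x
      linarith
    have h2 : √(d * F) * x = d := by
      rw [hx, ← Real.sqrt_mul (by positivity)]
      have : (d : ℝ) * F * (d / F) = d ^ 2 := by field_simp
      rw [this, Real.sqrt_sq (by positivity)]
    calc (d : ℝ) = √(d * F) * x := h2.symm
      _ ≤ √(d * F) * (2 * ((max 1 ⌊x⌋₊ : ℕ) : ℝ)) := by gcongr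
      _ = _ := by ring

set_option maxHeartbeats 1000000 in
/-- Parameters for which the failure probability of `drawLaw_not_learnsWithin_le` is at most `δ`. -/
theorem exists_parameters {c δ : ℝ} (hc : 1 ≤ c) (hδ0 : 0 < δ) (hδ1 : δ ≤ 1) :
    ∃ C : ℝ, ∀ (d k : ℕ), 1 ≤ d → 1 ≤ k → ∀ ε : ℝ, 0 < ε → ε ≤ 1 / 2 →
      ∃ (Q m s : ℕ) (β : unitInterval) (γ η : ℝ), 0 < m ∧ 0 < γ ∧ 0 ≤ η ∧
        (2 ≤ s → Real.exp (-(d / (2 * s ^ 2))) ≤ η) ∧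
        (s : ℝ) ≤ (β : ℝ) * (k * m) * ε / 8 ∧ 24 < γ ^ 2 * (s * Q) ∧
        Q * (2 * Real.exp (-(ε * (k * m) / 40))) +
          (Q * ((β : ℝ) * (k * m) * (c * (12 * γ * √d))) / (s * Q / 4) +
          Q * (Real.exp (-((β : ℝ) * (k * m) * ε / 40)) +
            (k * m : ℕ) * ((β : ℝ) * (k * (c * (2 * η))))) / (Q / 2)) ≤ δ ∧
        ((2 * k * Q : ℕ) : ℝ) ≤
          C * ((k : ℝ) ^ 2 * √((d : ℝ) * Real.log ((d : ℝ) * k / ε)) / ε ^ 2) ∧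
        ((2 * k * Q : ℕ) : ℝ) * m ≤ C * ((d : ℝ) * k / ε) ^ 6 := by
  -- A pass selects `K s / ε` examples on average. `A` and `B` ensure `exp (-B L) ≤ 1 / (A T) ≤ η`,
  -- with `L ≥ log 2` absorbing `log A`; `G d / ε²` equals `24 / γ²`, the value that `s Q` must
  -- exceed.
  set K := 640 / δ with hK
  have hK640 : 640 ≤ K := by rw [hK, le_div_iff₀ hδ0]; linarith
  have hK0 : 0 < K := by linarith
  set A := 32 * K * c / δ with hA
  have hA1 : 1 ≤ A := by rw [hA, le_div_iff₀ hδ0]; nlinarith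
  set B := Real.log A / Real.log 2 + 1 with hB
  have hlog2 : 0.6931 < Real.log 2 := lt_trans (by norm_num) Real.log_two_gt_d9
  have hB1 : 1 ≤ B := by
    have : 0 ≤ Real.log A / Real.log 2 := div_nonneg (Real.log_nonneg hA1) (by linarith)
    linarith
  set G := 24 * (192 * K * c / δ) ^ 2 with hG
  have hA0 : 0 < A := by linarith
  have hB0 : 0 < B := by linarith
  have hG0 : 0 < G := by positivity
  set C₁ := 2 * (2 * √(2 * B) * G + 1) with hC₁
  set C₂ := 2 * (G + 1) * (320 * (G + 1) / δ + K + 1) with hC₂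
  have hC₁0 : 0 ≤ C₁ := by positivity
  have hC₂0 : 0 ≤ C₂ := by positivity
  clear_value C₁ C₂ G B A
  refine ⟨C₁ + C₂, fun d k hd hk ε hε hε2 => ?_⟩
  have hd' : (1 : ℝ) ≤ d := by exact_mod_cast hd
  have hk' : (1 : ℝ) ≤ k := by exact_mod_cast hk
  set T := (d : ℝ) * k / ε with hT
  have hinvε : 2 ≤ 1 / ε := by rw [le_div_iff₀ hε]; linarith
  have hT' : T = d * k * (1 / ε) := by rw [hT]; ring
  have hTε : 1 / ε ≤ T := by
    rw [hT']; exact le_mul_of_one_le_left (by positivity) (one_le_mul_of_one_le_of_one_le hd' hk')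
  have hT2 : 2 ≤ T := hinvε.trans hTε
  have hTk : k ≤ T := by
    calc (k : ℝ) = 1 * k * 1 := by ring
      _ ≤ d * k * (1 / ε) := by gcongr; linarith
      _ = T := hT'.symm
  have hTd : d / ε ≤ T := by
    rw [hT]; gcongr; exact le_mul_of_one_le_right (by positivity) hk'
  set L := Real.log T with hL
  have hL2 : Real.log 2 ≤ L := Real.log_le_log two_pos hT2
  have hLpos : 0 < L := by linarith
  obtain ⟨s, hs1, hsd, hs2, hds⟩ := exists_update_target d hd (F := 2 * B * L) (by nlinarith)
  have hs1' : (1 : ℝ) ≤ s := by exact_mod_cast hs1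
  have hsd' : (s : ℝ) ≤ d := by exact_mod_cast hsd
  -- Chosen so that the Markov bound for near-boundary examples is exactly `δ / 4`; likewise `η`
  -- below makes the total disturbance probability of a pass `δ / 16`.
  set γ := ε * δ / (192 * K * c * √d) with hγ
  have hsqd : 0 < √(d : ℝ) := by positivity
  have hsqd2 : √(d : ℝ) ^ 2 = d := Real.sq_sqrt (by positivity)
  have hγ0 : 0 < γ := by positivity
  have hγG : γ ^ 2 * (G * d / ε ^ 2) = 24 := by
    rw [hγ, hG, div_pow, mul_pow _ (√(d : ℝ)), hsqd2]; field_simp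
  set η := δ * ε / (32 * K * c * k * s) with hη
  set Q := ⌊G * d / ε ^ 2 / s⌋₊ + 1 with hQ
  have hQlt : G * d / ε ^ 2 / s < Q := by
    rw [hQ]; push_cast; exact Nat.lt_floor_add_one _
  have hQle : (Q : ℝ) ≤ G * d / ε ^ 2 / s + 1 := by
    rw [hQ]; push_cast; gcongr; exact Nat.floor_le (by positivity)
  have hQ0 : (0 : ℝ) < Q := lt_trans (by positivity) hQlt
  -- The first term makes the union bound over the tests at most `δ / 4`; the second makes `β ≤ 1`
  -- possible.
  set m := ⌈320 * Q / (ε * δ) + K * s / ε⌉₊ with hm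
  have hmge : 320 * Q / (ε * δ) + K * s / ε ≤ m := Nat.le_ceil _
  have hmle : (m : ℝ) ≤ 320 * Q / (ε * δ) + K * s / ε + 1 := (Nat.ceil_lt_add_one (by positivity)).le
  have hm0 : (0 : ℝ) < m := lt_of_lt_of_le (by positivity) hmge
  have hkm : (m : ℝ) ≤ k * m := le_mul_of_one_le_left hm0.le hk'
  have hKsm : K * s / ε ≤ k * m := by
    have : 0 ≤ 320 * Q / (ε * δ) := by positivity
    linarith
  have hQm : 320 * Q / (ε * δ) ≤ k * m := by
    have : 0 ≤ K * s / ε := by positivity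
    linarith
  have hkm0 : (0 : ℝ) < k * m := by positivity
  obtain ⟨β, hβ⟩ : ∃ β : unitInterval, (β : ℝ) * (k * m) = K * s / ε :=
    ⟨⟨K * s / ε / (k * m), by positivity, by rwa [div_le_one hkm0]⟩, div_mul_cancel₀ _ hkm0.ne'⟩
  have hη0 : 0 ≤ η := by positivity
  clear_value m Q η γ L T K
  have hβε : (β : ℝ) * (k * m) * ε = K * s := by rw [hβ]; field_simp
  refine ⟨Q, m, s, β, γ, η, by exact_mod_cast hm0, hγ0, hη0, fun h2 => ?_, ?_, ?_, ?_,
    ?_, ?_⟩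
  · have h1 := hs2 h2
    have h3 : B * L ≤ d / (2 * s ^ 2) := by
      rw [le_div_iff₀ (by positivity)]; linarith
    have h4 : Real.log (A * T) ≤ B * L := by
      rw [Real.log_mul (by positivity) (by positivity), hB]
      have h5 : Real.log A / Real.log 2 * Real.log 2 ≤ Real.log A / Real.log 2 * L :=
        mul_le_mul_of_nonneg_left hL2 (div_nonneg (Real.log_nonneg hA1) (by linarith))
      rw [div_mul_cancel₀ _ (by linarith)] at h5
      linarith
    calc Real.exp (-(d / (2 * s ^ 2))) ≤ Real.exp (-Real.log (A * T)) :=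
          Real.exp_le_exp.2 (by linarith)
      _ = 1 / (A * T) := by
          rw [Real.exp_neg, Real.exp_log (by positivity), one_div]
      _ = δ * ε / (32 * K * c * k * d) := by rw [hA, hT]; field_simp
      _ ≤ η := by rw [hη]; gcongr
  · rw [hβε]
    have : 640 * (s : ℝ) ≤ K * s := by gcongr
    linarith
  · calc (24 : ℝ) = γ ^ 2 * (G * d / ε ^ 2) := hγG.symm
      _ < γ ^ 2 * (s * Q) := by
        gcongr
        rw [div_lt_iff₀ (by positivity)] at hQlt
        linarith
  · have hB₁ : Q * (2 * Real.exp (-(ε * (k * m) / 40))) ≤ δ / 4 := by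
      have h1 : 8 * Q / δ ≤ ε * (k * m) / 40 := by
        calc 8 * Q / δ = ε * (320 * Q / (ε * δ)) / 40 := by field_simp; norm_num
          _ ≤ _ := by gcongr
      calc Q * (2 * Real.exp (-(ε * (k * m) / 40))) ≤ Q * (2 * (1 / (8 * Q / δ))) := by
            gcongr
            exact (Real.exp_le_exp.2 (neg_le_neg h1)).trans (exp_neg_le_inv (by positivity))
        _ = δ / 4 := by field_simp; norm_num
    have hB₂ : Q * ((β : ℝ) * (k * m) * (c * (12 * γ * √d))) / (s * Q / 4) = δ / 4 := by
      rw [hβ, hγ]; field_simp; norm_num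
    have hB₃ : Q * (Real.exp (-((β : ℝ) * (k * m) * ε / 40)) +
            (k * m : ℕ) * ((β : ℝ) * (k * (c * (2 * η))))) / (Q / 2) ≤ δ / 4 := by
      have h1 : Real.exp (-((β : ℝ) * (k * m) * ε / 40)) ≤ δ / 16 := by
        rw [hβε]
        calc Real.exp (-(K * s / 40)) ≤ Real.exp (-(K / 40)) := by
              rw [Real.exp_le_exp]
              have : K * 1 ≤ K * s := by gcongr
              linarith
          _ ≤ 1 / (K / 40) := exp_neg_le_inv (by positivity)
          _ = δ / 16 := by rw [hK]; field_simp; norm_num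
      have h2 : ((k * m : ℕ) : ℝ) * ((β : ℝ) * (k * (c * (2 * η)))) = δ / 16 := by
        calc _ = (β : ℝ) * (k * m) * (k * (c * (2 * η))) := by push_cast; ring
          _ = δ / 16 := by rw [hβ, hη]; field_simp; norm_num
      rw [h2]
      calc _ ≤ Q * (δ / 16 + δ / 16) / (Q / 2) := by gcongr
        _ = δ / 4 := by field_simp; norm_num
    linarith
  · have hsq : √((d : ℝ) * (2 * B * L)) = √(2 * B) * √(d * L) := by
      rw [← Real.sqrt_mul (by positivity)]; congr 1; ring
    rw [hsq] at hds
    set S := √((d : ℝ) * L) with hS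
    have hS0 : 0 ≤ S := Real.sqrt_nonneg _
    -- Absorbs the `+ 1` from rounding `Q`.
    have hS1 : 1 ≤ S / ε ^ 2 := by
      rw [le_div_iff₀ (by positivity), hS, one_mul]
      refine Real.le_sqrt_of_sq_le ?_
      have h1 : ε ^ 2 ≤ (1 / 2) ^ 2 := pow_le_pow_left₀ hε.le hε2 2
      have h2 : (ε ^ 2) ^ 2 ≤ ((1 / 2) ^ 2) ^ 2 := pow_le_pow_left₀ (sq_nonneg ε) h1 2
      have h3 : 1 * L ≤ d * L := mul_le_mul_of_nonneg_right hd' hLpos.le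
      linarith
    have hQ1 : (Q : ℝ) ≤ (2 * √(2 * B) * G + 1) * (S / ε ^ 2) := by
      have h1 : G * d / ε ^ 2 / s ≤ 2 * √(2 * B) * G * (S / ε ^ 2) := by
        rw [div_le_iff₀ (by positivity)]
        calc G * d / ε ^ 2 ≤ G * (2 * (√(2 * B) * S) * s) / ε ^ 2 := by gcongr
          _ = _ := by ring
      linarith
    -- The construction uses only the first power of `k` outside the logarithm; the square in the
    -- claim is slack.
    have hkk : (k : ℝ) ≤ k ^ 2 := le_self_pow₀ hk' two_ne_zero
    calc ((2 * k * Q : ℕ) : ℝ) = 2 * k * Q := by push_cast; ring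
      _ ≤ 2 * k ^ 2 * ((2 * √(2 * B) * G + 1) * (S / ε ^ 2)) := by gcongr
      _ = C₁ * ((k : ℝ) ^ 2 * S / ε ^ 2) := by rw [hC₁]; ring
      _ ≤ _ := by gcongr; linarith
  · have hdT : d / ε ^ 2 ≤ T ^ 2 := by
      calc (d : ℝ) / ε ^ 2 = d / ε * (1 / ε) := by field_simp
        _ ≤ T * T := by gcongr
        _ = T ^ 2 := by ring
    have hT1 : 1 ≤ T := by linarith
    have hQT : (Q : ℝ) ≤ (G + 1) * T ^ 2 := by
      have h1 : G * d / ε ^ 2 / s ≤ G * T ^ 2 := by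
        calc G * d / ε ^ 2 / s ≤ G * d / ε ^ 2 := div_le_self (by positivity) hs1'
          _ = G * (d / ε ^ 2) := by ring
          _ ≤ _ := by gcongr
      have h2 : 1 ≤ T ^ 2 := one_le_pow₀ hT1
      linarith
    have hmT : (m : ℝ) ≤ (320 * (G + 1) / δ + K + 1) * T ^ 3 := by
      have h1 : 320 * Q / (ε * δ) ≤ 320 * (G + 1) / δ * T ^ 3 := by
        calc 320 * Q / (ε * δ) = 320 / δ * Q * (1 / ε) := by field_simp
          _ ≤ 320 / δ * ((G + 1) * T ^ 2) * T := by gcongr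
          _ = _ := by ring
      have h2 : K * s / ε ≤ K * T ^ 3 := by
        calc K * s / ε ≤ K * d / ε := by gcongr
          _ = K * (d / ε) := by ring
          _ ≤ K * T := by gcongr
          _ ≤ K * T ^ 3 := by gcongr; exact le_self_pow₀ hT1 (by norm_num)
      have h3 : 1 ≤ T ^ 3 := one_le_pow₀ hT1
      linarith
    calc ((2 * k * Q : ℕ) : ℝ) * m = 2 * k * Q * m := by push_cast; ring
      _ ≤ 2 * T * ((G + 1) * T ^ 2) * ((320 * (G + 1) / δ + K + 1) * T ^ 3) := by gcongr
      _ = C₂ * T ^ 6 := by rw [hC₂]; ring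
      _ ≤ _ := by gcongr; linarith

end

/-! ### Conclusion -/

theorem theorem7 :
    ∃ p : ℕ, ∀ c δ : ℝ, 0 < c → 0 < δ →
      ∃ C : ℝ, ∀ (d k : ℕ) [NeZero d] [NeZero k] (ε : ℝ), 0 < ε → ε ≤ 1 / 2 →
        ∃ (R m : ℕ) (β : unitInterval),
          (R : ℝ) ≤ C * ((k : ℝ) ^ 2 * √((d : ℝ) * Real.log ((d : ℝ) * k / ε)) / ε ^ 2) ∧
          (R : ℝ) * m ≤ C * ((d : ℝ) * k / ε) ^ p ∧
          ∀ (D : Fin k → Measure (SpherePt d)) [∀ i, IsProbabilityMeasure (D i)],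
            NonConcentrated c (mixture D) →
            ∀ wstar : EuclideanSpace ℝ (Fin d), wstar ≠ 0 →
              drawLaw m D {ω | ¬ LearnsWithin k m β ε R (mixture D) wstar (labelDraws wstar ω)}
                ≤ ENNReal.ofReal δ := by
  refine ⟨6, fun c δ hc hδ => ?_⟩
  -- Enlarging `c` to at least 1 and shrinking `δ` to at most 1 only strengthens the claim and keeps
  -- `A ≥ 1` and `K ≥ 640`.
  obtain ⟨C, hC⟩ := exists_parameters (c := max c 1) (δ := min δ 1) (le_max_right _ _)
    (lt_min hδ one_pos) (min_le_right _ _)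
  refine ⟨C, fun d k _ _ ε hε hε2 => ?_⟩
  obtain ⟨Q, m, s, β, γ, η, hm, hγ, hη0, hη, hs, hQ, hle, hR, hRm⟩ :=
    hC d k NeZero.one_le NeZero.one_le ε hε hε2
  refine ⟨2 * k * Q, m, β, hR, hRm, fun D _ hD wstar hw => ?_⟩
  have : NeZero m := ⟨hm.ne'⟩
  have hw0 : 0 < ‖wstar‖⁻¹ := inv_pos.2 (norm_pos_iff.2 hw)
  -- Labels and errors depend only on the direction of the target, so it may be taken of length one.
  have h := drawLaw_not_learnsWithin_le (‖wstar‖⁻¹ • wstar) β D m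
    (zero_le_one.trans (le_max_right c 1)) (hD.mono (le_max_left c 1)) (norm_smul_inv_norm hw)
    hγ hη0 hη hε.le hs hQ
  simp only [learnsWithin_smul β ε _ _ hw0] at h
  exact h.trans (ENNReal.ofReal_le_ofReal (hle.trans (min_le_left _ _)))
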